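/- **Notation.** Let $d$ be a dimension and let $(u,\phi)$ denote the action of a tempered distribution $u\in\mathscr S'(\mathbf R^n)$ on $\phi\in\mathscr S(\mathbf R^n)$, linear in $u$ and conjugate linear in $\phi$, extending the $L^2$ inner product. For a window $\varphi\in\mathscr S(\mathbf R^n)\setminus\{0\}$ the short-time Fourier transform of $u\in\mathscr S'(\mathbf R^n)$ is $$V_\varphi u(x,\xi)=(2\pi)^{-n/2}\,(u,M_\xi T_x\varphi),\qquad M_\xi T_x\varphi(y)=e^{i\langle y,\xi\rangle}\varphi(y-x),\qquad x,\xi\in\mathbf R^n .$$ For $s>0$ the $s$-Gabor wave front set $\mathrm{WF}_{\rm g}^s(u)\subseteq \mathbf R^{2n}\setminus\{0\}$, defined with a fixed but arbitrary nonzero Schwartz window $\varphi$, is the set of all $z_0\in\mathbf R^{2n}\setminus\{0\}$ for which there is no open set $U\subseteq\mathbf R^{2n}$ with $z_0\in U$ and $$\sup_{(x,\xi)\in U,\ \lambda>0}\lambda^N\,|V_\varphi u(\lambda x,\lambda^s\xi)|<\infty\qquad\text{for all } N\ge 0 .$$ For $K\in\mathscr S'(\mathbf R^{2d})$ put $$\mathrm{WF}_{\rm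 g,1}^s(K)=\{(x,\xi)\in\mathbf R^{2d}:(x,0,\xi,0)\in\mathrm{WF}_{\rm g}^s(K)\},\qquad \mathrm{WF}_{\rm g,2}^s(K)=\{(y,\eta)\in\mathbf R^{2d}:(0,y,0,-\eta)\in\mathrm{WF}_{\rm g}^s(K)\},$$ and let $\mathscr K:\mathscr S(\mathbf R^d)\to\mathscr S'(\mathbf R^d)$ be the continuous linear operator with kernel $K$, that is $(\mathscr K f,g)=(K,g\otimes\overline f)$ for $f,g\in\mathscr S(\mathbf R^d)$, where $(g\otimes h)(x,y)=g(x)h(y)$. **Proposition 4.2.** Let $s>0$ and $K\in\mathscr S'(\mathbf R^{2d})$. If $\mathrm{WF}_{\rm g,1}^s(K)=\mathrm{WF}_{\rm g,2}^s(K)=\emptyset$, then (i) $\mathscr K$ maps $\mathscr S(\mathbf R^d)$ into $\mathscr S(\mathbf R^d)$, and $\mathscr K:\mathscr S(\mathbf R^d)\to\mathscr S(\mathbf R^d)$ is continuous; (ii) $\mathscr K$ extends uniquely to a sequentially continuous linear operator $\mathscr K:\mathscr S'(\mathbf R^d)\to\mathscr S'(\mathbf R^d)$, where $\mathscr S'(\mathbf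 R^d)$ carries the weak-$*$ topology; (iii) if $\varphi\in\mathscr S(\mathbf R^d)$, $\|\varphi\|_{L^2}=1$, $\Phi=\varphi\otimes\varphi\in\mathscr S(\mathbf R^{2d})$, $u\in\mathscr S'(\mathbf R^d)$ and $\psi\in\mathscr S(\mathbf R^d)$, then the extension in (ii) satisfies $$(\mathscr K u,\psi)=\int_{\mathbf R^{4d}}V_\Phi K(x,y,\xi,-\eta)\,\overline{V_\varphi\psi(x,\xi)}\,V_{\overline\varphi}u(y,\eta)\,\mathrm dx\,\mathrm dy\,\mathrm d\xi\,\mathrm d\eta ,$$ and this integral converges absolutely. -/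

import Mathlib

open MeasureTheory SchwartzMap

noncomputable section

namespace GaborWF

/-- `ℝᵈ` with its Euclidean structure. -/
abbrev Rd (d : ℕ) : Type := EuclideanSpace ℝ (Fin d)

/-- `ℝ²ᵈ = ℝᵈ × ℝᵈ` with its Euclidean structure; the point `(x, y)` is `WithLp.toLp 2 (x, y)`. -/
abbrev R2d (d : ℕ) : Type := WithLp 2 (Rd d × Rd d)

section Conj

variable {V : Type*} [NormedAddCommGroup V] [NormedSpace ℝ V]

/-- The complex conjugate `x ↦ conj (φ x)` of a Schwartz function. -/
def conjS (φ : 𝓢(V, ℂ)) : 𝓢(V, ℂ) :=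
  SchwartzMap.postcompCLM (𝕜 := ℝ) (Complex.conjCLE : ℂ →L[ℝ] ℂ) φ

theorem conjS_apply (φ : 𝓢(V, ℂ)) (x : V) : conjS φ x = (starRingEnd ℂ) (φ x) := rfl

/-- The pairing `(u, φ)`, linear in the distribution `u` and conjugate linear in the test function
`φ`, which extends the `L²` inner product `∫ u(x) conj (φ x) dx`. Mathlib's tempered distributions
act linearly, so `(u, φ) = u (conj φ)`. -/
def pair (u : 𝓢'(V, ℂ)) (φ : 𝓢(V, ℂ)) : ℂ := u (conjS φ)

end Conj

section STFT

variable {V : Type*} [NormedAddCommGroup V] [InnerProductSpace ℝ V]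

theorem iteratedDeriv_expI (n : ℕ) :
    iteratedDeriv n (fun t : ℝ => Complex.exp (t * Complex.I))
      = fun t : ℝ => Complex.I ^ n * Complex.exp (t * Complex.I) := by
  induction n with
  | zero => simp
  | succ n ih =>
    rw [iteratedDeriv_succ, ih]
    funext t
    have h : HasDerivAt (fun t : ℝ => Complex.exp (t * Complex.I))
        (Complex.exp (t * Complex.I) * (1 * Complex.I)) t :=
      ((Complex.ofRealCLM.hasDerivAt (x := t)).mul_const Complex.I).cexp
    rw [(h.const_mul (Complex.I ^ n)).deriv]
    ring

theorem hasTemperateGrowth_expI :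
    (fun t : ℝ => Complex.exp (t * Complex.I)).HasTemperateGrowth := by
  refine ⟨(Complex.ofRealCLM.contDiff.mul contDiff_const).cexp, fun n => ⟨0, 1, fun t => ?_⟩⟩
  rw [norm_iteratedFDeriv_eq_norm_iteratedDeriv, iteratedDeriv_expI]
  simp [Complex.norm_exp_ofReal_mul_I]

theorem hasTemperateGrowth_character (ξ : V) :
    (fun y : V => Complex.exp ((inner ℝ y ξ : ℝ) * Complex.I)).HasTemperateGrowth :=
  hasTemperateGrowth_expI.comp (Function.hasTemperateGrowth_inner_left ξ)

/-- The time-frequency shift `Π(x, ξ) φ = M_ξ T_x φ`, that is `y ↦ exp(i⟨y, ξ⟩) φ(y - x)`. -/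
def timeFreqShift (x ξ : V) (φ : 𝓢(V, ℂ)) : 𝓢(V, ℂ) :=
  SchwartzMap.smulLeftCLM ℂ (fun y : V => Complex.exp ((inner ℝ y ξ : ℝ) * Complex.I))
    (SchwartzMap.compSubConstCLM ℂ x φ)

theorem timeFreqShift_apply (x ξ : V) (φ : 𝓢(V, ℂ)) (y : V) :
    timeFreqShift x ξ φ y = Complex.exp ((inner ℝ y ξ : ℝ) * Complex.I) * φ (y - x) := by
  simp [timeFreqShift, SchwartzMap.smulLeftCLM_apply_apply (hasTemperateGrowth_character ξ)]

/-- The short-time Fourier transform `V_φ u (x, ξ) = (2π)^{-n/2} (u, M_ξ T_x φ)`, `n = dim V`. -/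
def stft (φ : 𝓢(V, ℂ)) (u : 𝓢'(V, ℂ)) (x ξ : V) : ℂ :=
  (((2 * Real.pi) ^ (-(Module.finrank ℝ V : ℝ) / 2) : ℝ) : ℂ) * pair u (timeFreqShift x ξ φ)

/-- The `s`-Gabor wave front set of `u`, computed with the window `φ`: a subset of
`T*V ∖ 0 = (V × V) ∖ {0}`. A nonzero point `z₀` lies outside it iff there is an open `U ∋ z₀` with
`sup_{(x, ξ) ∈ U, t > 0} t ^ N |V_φ u (t x, t ^ s ξ)| < ∞` for every `N`. -/
def gaborWF (s : ℝ) (φ : 𝓢(V, ℂ)) (u : 𝓢'(V, ℂ)) : Set (V × V) :=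
  {z₀ | z₀ ≠ 0 ∧ ¬ ∃ U : Set (V × V), IsOpen U ∧ z₀ ∈ U ∧
    ∀ N : ℕ, ∃ C : ℝ, ∀ z ∈ U, ∀ t : ℝ, 0 < t →
      t ^ N * ‖stft φ u (t • z.1) (t ^ s • z.2)‖ ≤ C}

end STFT

section Tensor

variable {V W : Type*} [NormedAddCommGroup V] [InnerProductSpace ℝ V]
  [NormedAddCommGroup W] [InnerProductSpace ℝ W]

/-- `(g ⊗ f)(x, y) = g(x) f(y)`, as a function. -/
def tensorFun (g : 𝓢(V, ℂ)) (f : 𝓢(W, ℂ)) (z : WithLp 2 (V × W)) : ℂ := g z.fst * f z.snd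

theorem contDiff_tensorFun (g : 𝓢(V, ℂ)) (f : 𝓢(W, ℂ)) :
    ContDiff ℝ (⊤ : ℕ∞) (tensorFun g f) :=
  ((g.smooth ⊤).comp (WithLp.fstL 2 ℝ V W).contDiff).mul
    ((f.smooth ⊤).comp (WithLp.sndL 2 ℝ V W).contDiff)

theorem norm_iteratedFDeriv_comp_le {E F : Type*} [NormedAddCommGroup E] [NormedSpace ℝ E]
    [NormedAddCommGroup F] [NormedSpace ℝ F] (L : E →L[ℝ] F) (hL : ‖L‖ ≤ 1) (g : 𝓢(F, ℂ)) (i : ℕ)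
    (z : E) : ‖iteratedFDeriv ℝ i (g ∘ L) z‖ ≤ ‖iteratedFDeriv ℝ i g (L z)‖ := by
  rw [L.iteratedFDeriv_comp_right (g.smooth ⊤) z (mod_cast le_top)]
  refine (ContinuousMultilinearMap.norm_compContinuousLinearMap_le _ _).trans ?_
  refine mul_le_of_le_one_right (norm_nonneg _) ?_
  exact Finset.prod_le_one (fun _ _ => norm_nonneg _) (fun _ _ => hL)

theorem tensorFun_bound (k n : ℕ) (g : 𝓢(V, ℂ)) (f : 𝓢(W, ℂ)) (z : WithLp 2 (V × W)) :
    ‖z‖ ^ k * ‖iteratedFDeriv ℝ n (tensorFun g f) z‖ ≤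
      (2 ^ n * 2 ^ k * 2 ^ k) * (Finset.Iic (k, n)).sup (schwartzSeminormFamily ℂ V ℂ) g
        * (Finset.Iic (k, n)).sup (schwartzSeminormFamily ℂ W ℂ) f := by
  have hfst : ‖WithLp.fstL 2 ℝ V W‖ ≤ 1 :=
    ContinuousLinearMap.opNorm_le_bound _ zero_le_one fun z => by
      simpa using WithLp.norm_fst_le (p := 2) V z
  have hsnd : ‖WithLp.sndL 2 ℝ V W‖ ≤ 1 :=
    ContinuousLinearMap.opNorm_le_bound _ zero_le_one fun z => by
      simpa using WithLp.norm_snd_le (p := 2) V z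
  have hz : ‖z‖ ≤ (1 + ‖z.fst‖) * (1 + ‖z.snd‖) := by
    have h : ‖z‖ ≤ ‖z.fst‖ + ‖z.snd‖ := by
      rw [WithLp.prod_norm_eq_of_L2]
      refine Real.sqrt_le_iff.mpr ⟨by positivity, ?_⟩
      nlinarith [norm_nonneg z.fst, norm_nonneg z.snd]
    nlinarith [norm_nonneg z.fst, norm_nonneg z.snd, mul_nonneg (norm_nonneg z.fst) (norm_nonneg z.snd)]
  set G := (Finset.Iic (k, n)).sup (schwartzSeminormFamily ℂ V ℂ) g with hG
  set H := (Finset.Iic (k, n)).sup (schwartzSeminormFamily ℂ W ℂ) f with hH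
  have hmul := norm_iteratedFDeriv_mul_le (𝕜 := ℝ) (N := (⊤ : ℕ∞))
    ((g.smooth ⊤).comp (WithLp.fstL 2 ℝ V W).contDiff)
    ((f.smooth ⊤).comp (WithLp.sndL 2 ℝ V W).contDiff) z (n := n) (mod_cast le_top)
  have key : ∀ i ∈ Finset.range (n + 1),
      ‖z‖ ^ k * ((n.choose i : ℝ) * ‖iteratedFDeriv ℝ i (g ∘ WithLp.fstL 2 ℝ V W) z‖ *
        ‖iteratedFDeriv ℝ (n - i) (f ∘ WithLp.sndL 2 ℝ V W) z‖)
      ≤ (n.choose i : ℝ) * ((2 ^ k * G) * (2 ^ k * H)) := by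
    intro i hi
    have h1 : (1 + ‖z.fst‖) ^ k * ‖iteratedFDeriv ℝ i g z.fst‖ ≤ 2 ^ k * G :=
      SchwartzMap.one_add_le_sup_seminorm_apply (𝕜 := ℂ) (m := (k, n)) le_rfl
        (Nat.lt_succ_iff.mp (Finset.mem_range.mp hi)) g z.fst
    have h2 : (1 + ‖z.snd‖) ^ k * ‖iteratedFDeriv ℝ (n - i) f z.snd‖ ≤ 2 ^ k * H :=
      SchwartzMap.one_add_le_sup_seminorm_apply (𝕜 := ℂ) (m := (k, n)) le_rfl
        (Nat.sub_le n i) f z.snd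
    calc _ ≤ ((1 + ‖z.fst‖) * (1 + ‖z.snd‖)) ^ k *
          ((n.choose i : ℝ) * ‖iteratedFDeriv ℝ i g z.fst‖ *
            ‖iteratedFDeriv ℝ (n - i) f z.snd‖) := by
          gcongr
          · exact norm_iteratedFDeriv_comp_le _ hfst g i z
          · exact norm_iteratedFDeriv_comp_le _ hsnd f (n - i) z
      _ = (n.choose i : ℝ) * (((1 + ‖z.fst‖) ^ k * ‖iteratedFDeriv ℝ i g z.fst‖) *
            ((1 + ‖z.snd‖) ^ k * ‖iteratedFDeriv ℝ (n - i) f z.snd‖)) := by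
          rw [mul_pow]; ring
      _ ≤ _ := by gcongr
  calc ‖z‖ ^ k * ‖iteratedFDeriv ℝ n (tensorFun g f) z‖
      ≤ ‖z‖ ^ k * ∑ i ∈ Finset.range (n + 1), (n.choose i : ℝ) *
          ‖iteratedFDeriv ℝ i (g ∘ WithLp.fstL 2 ℝ V W) z‖ *
          ‖iteratedFDeriv ℝ (n - i) (f ∘ WithLp.sndL 2 ℝ V W) z‖ := by
        gcongr
        exact hmul
    _ ≤ ∑ i ∈ Finset.range (n + 1), (n.choose i : ℝ) * ((2 ^ k * G) * (2 ^ k * H)) := by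
        rw [Finset.mul_sum]
        exact Finset.sum_le_sum key
    _ = _ := by
        rw [← Finset.sum_mul]
        have : (∑ i ∈ Finset.range (n + 1), (n.choose i : ℝ)) = 2 ^ n := by
          exact_mod_cast Nat.sum_range_choose n
        rw [this]; ring

/-- `g ↦ g ⊗ f` for fixed `f`. -/
def tensorLeftCLM (f : 𝓢(W, ℂ)) : 𝓢(V, ℂ) →L[ℂ] 𝓢(WithLp 2 (V × W), ℂ) :=
  SchwartzMap.mkCLM (fun g => tensorFun g f)
    (fun _ _ _ => by simp [tensorFun, add_mul]) (fun _ _ _ => by simp [tensorFun, mul_assoc])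
    (fun g => contDiff_tensorFun g f)
    (fun m => ⟨Finset.Iic m, (2 ^ m.2 * 2 ^ m.1 * 2 ^ m.1) *
        (Finset.Iic m).sup (schwartzSeminormFamily ℂ W ℂ) f, by positivity, fun g z => by
      have h := tensorFun_bound m.1 m.2 g f z
      linarith⟩)

/-- `f ↦ g ⊗ f` for fixed `g`. -/
def tensorRightCLM (g : 𝓢(V, ℂ)) : 𝓢(W, ℂ) →L[ℂ] 𝓢(WithLp 2 (V × W), ℂ) :=
  SchwartzMap.mkCLM (fun f => tensorFun g f)
    (fun _ _ _ => by simp [tensorFun, mul_add])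
    (fun _ _ _ => by simp [tensorFun, mul_left_comm])
    (fun f => contDiff_tensorFun g f)
    (fun m => ⟨Finset.Iic m, (2 ^ m.2 * 2 ^ m.1 * 2 ^ m.1) *
        (Finset.Iic m).sup (schwartzSeminormFamily ℂ V ℂ) g, by positivity, fun f z =>
      tensorFun_bound m.1 m.2 g f z⟩)

/-- The tensor product `(g ⊗ f)(x, y) = g(x) f(y)` of Schwartz functions. -/
def tensor (g : 𝓢(V, ℂ)) (f : 𝓢(W, ℂ)) : 𝓢(WithLp 2 (V × W), ℂ) := tensorLeftCLM f g

theorem tensor_apply (g : 𝓢(V, ℂ)) (f : 𝓢(W, ℂ)) (z : WithLp 2 (V × W)) :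
    tensor g f z = g z.fst * f z.snd := rfl

theorem tensorRightCLM_eq (g : 𝓢(V, ℂ)) (f : 𝓢(W, ℂ)) : tensorRightCLM g f = tensor g f := rfl

end Tensor

section Kernel

variable {d : ℕ}

/-- The continuous operator `𝒦 : 𝓢(ℝᵈ) → 𝓢'(ℝᵈ)` with Schwartz kernel `K ∈ 𝓢'(ℝ²ᵈ)`. In terms of
linear actions `(𝒦 f)(g) = K(g ⊗ f)`; `pair_kernelOp` is the same identity for the conjugate linear
pairing. -/
def kernelOp (K : 𝓢'(R2d d, ℂ)) : 𝓢(Rd d, ℂ) →L[ℂ] 𝓢'(Rd d, ℂ) where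
  toFun f := PointwiseConvergenceCLM.precomp ℂ (tensorLeftCLM f) K
  map_add' f₁ f₂ := by
    ext g
    change K (tensorRightCLM g (f₁ + f₂)) = K (tensorRightCLM g f₁) + K (tensorRightCLM g f₂)
    rw [map_add, map_add]
  map_smul' c f := by
    ext g
    change K (tensorRightCLM g (c • f)) = c • K (tensorRightCLM g f)
    rw [map_smul, map_smul]
  cont := PointwiseConvergenceCLM.continuous_of_continuous_eval fun g => by
    change Continuous fun f => K (tensorRightCLM g f)
    exact (ContinuousLinearMap.continuous K).comp (tensorRightCLM g).continuous

/-- `(𝒦 f, g) = (K, g ⊗ conj f)`. -/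
theorem pair_kernelOp (K : 𝓢'(R2d d, ℂ)) (f g : 𝓢(Rd d, ℂ)) :
    pair (kernelOp K f) g = pair K (tensor g (conjS f)) := by
  change K (tensor (conjS g) f) = K (conjS (tensor g (conjS f)))
  congr 1
  ext z
  simp [tensor_apply, conjS_apply]

/-- `WF_{g,1}^s(K) = {(x, ξ) : (x, 0, ξ, 0) ∈ WF_g^s(K)}`, with window `Ψ`. -/
def gaborWF₁ (s : ℝ) (Ψ : 𝓢(R2d d, ℂ)) (K : 𝓢'(R2d d, ℂ)) : Set (Rd d × Rd d) :=
  {p | (WithLp.toLp 2 (p.1, 0), WithLp.toLp 2 (p.2, 0)) ∈ gaborWF s Ψ K}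

/-- `WF_{g,2}^s(K) = {(y, η) : (0, y, 0, -η) ∈ WF_g^s(K)}`, with window `Ψ`. -/
def gaborWF₂ (s : ℝ) (Ψ : 𝓢(R2d d, ℂ)) (K : 𝓢'(R2d d, ℂ)) : Set (Rd d × Rd d) :=
  {p | (WithLp.toLp 2 (0, p.1), WithLp.toLp 2 (0, -p.2)) ∈ gaborWF s Ψ K}

/-- The integrand `V_Φ K(x, y, ξ, -η) conj (V_φ ψ(x, ξ)) V_{conj φ} u(y, η)`, `Φ = φ ⊗ φ`, at the
point `p = (x, y, ξ, η)` of `ℝ⁴ᵈ`. -/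
def phaseSpaceIntegrand (K : 𝓢'(R2d d, ℂ)) (φ ψ : 𝓢(Rd d, ℂ)) (u : 𝓢'(Rd d, ℂ)) :
    Rd d × Rd d × Rd d × Rd d → ℂ := fun (x, y, ξ, η) =>
  stft (tensor φ φ) K (WithLp.toLp 2 (x, y)) (WithLp.toLp 2 (ξ, -η))
    * (starRingEnd ℂ) (stft φ (ψ : 𝓢'(Rd d, ℂ)) x ξ)
    * stft (conjS φ) u y η

end Kernel

end GaborWF

end

noncomputable section

namespace GaborWF

open FourierTransform

/-! ### Translations on the Schwartz space: seminorm bounds and continuity. -/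

section SchwartzSeminorms

variable {V : Type*} [NormedAddCommGroup V] [NormedSpace ℝ V]

/-! Write `Π(z)γ` for the time-frequency shift of a window `γ` with `‖γ‖ = 1` in `L²`. The inversion
formula expands every Schwartz function as an integral of shifts `Π(z)γ` with coefficients `V_γ
f(z)`, so the bilinear form `(g, f) ↦ K(g ⊗ f)` is determined by its matrix coefficients `K(Π(w)γ ⊗
Π(z)γ)`. Up to a constant and a sign in frequency these are values of a short-time Fourier transform
of `K` at the phase space point with components `w = (x, ξ)` and `z = (y, η)`.

The core is a decay estimate. If `WF_{g,2}(K)` is empty, compactness of the unit sphere yields an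
anisotropic cone `|w| ≤ ε|z|` on which the transform of `K` decays rapidly. Outside that cone `z` is
polynomially controlled by `w`, and every short-time Fourier transform grows at most polynomially.
Together these give, for each `N`, a bound `⟨z⟩^N |V K| ≤ C⟨w⟩^M` (`exists_decay_of_aniso`). The
weights are submultiplicative, so the bound survives a change of window (`exists_weighted_stft_le`).
Emptiness of `WF_{g,1}(K)` gives the same bound with `w` and `z` exchanged.

Expanding one argument by inversion, rapid decay in the other argument makes the form act through a
Schwartz function: `T g = c ∫ K(g ⊗ Π(z)γ) conj(Π(z)γ) dz` is an absolutely convergent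
Schwartz-valued integral, continuous in `g` (`exists_operator_of_decay`). Decay in `(x, ξ)` produces
the restriction of `𝒦` to `𝓢 → 𝓢`. Decay in `(y, η)` produces a transpose `T₂ : 𝓢 → 𝓢`, and `u ↦ u ∘
T₂` is the extension to `𝓢'`. It is unique because truncated inversion integrals make `𝓢`
sequentially dense (`exists_tendsto_schwartz`). Applying `u` under the integral for `T`, now with
window `conj φ`, and expanding `conj ψ` by inversion gives the phase space formula.

Applying a distribution under the integral sign rests on factoring it through a Banach space of jets
(`exists_eq_comp_jet`), where Bochner integration is available. -/

theorem continuous_finset_sup_schwartzSeminormFamily (s : Finset (ℕ × ℕ)) :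
    Continuous ⇑(s.sup (schwartzSeminormFamily ℂ V ℂ)) := by
  refine Seminorm.continuous_of_le (q := ∑ i ∈ s, schwartzSeminormFamily ℂ V ℂ i) ?_
    (Seminorm.finset_sup_le_sum _ _)
  have : ⇑(∑ i ∈ s, schwartzSeminormFamily ℂ V ℂ i)
      = fun f => ∑ i ∈ s, schwartzSeminormFamily ℂ V ℂ i f := by
    ext f
    simp
  rw [this]
  exact continuous_finsetSum _ fun i _ =>
    (schwartz_withSeminorms ℂ V ℂ).continuous_seminorm i

/-- A continuous seminorm on `𝓢` is dominated by one of the standard directed family. -/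
theorem exists_le_sup_Iic (q : Seminorm ℂ 𝓢(V, ℂ)) (hq : Continuous q) :
    ∃ (m : ℕ × ℕ) (C : NNReal),
      ∀ f, q f ≤ C * (Finset.Iic m).sup (schwartzSeminormFamily ℂ V ℂ) f := by
  obtain ⟨s, C, -, h⟩ := Seminorm.bound_of_continuous (schwartz_withSeminorms ℂ V ℂ) q hq
  refine ⟨s.sup id, C, fun f => (h f).trans ?_⟩
  have hle : s.sup (schwartzSeminormFamily ℂ V ℂ)
      ≤ (Finset.Iic (s.sup id)).sup (schwartzSeminormFamily ℂ V ℂ) :=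
    Finset.sup_mono fun i hi => Finset.mem_Iic.mpr (Finset.le_sup (f := id) hi)
  change (C : ℝ) * _ ≤ _
  exact mul_le_mul_of_nonneg_left (hle f) C.2

theorem seminorm_compSubConst_le (k n : ℕ) (x : V) (f : 𝓢(V, ℂ)) :
    SchwartzMap.seminorm ℂ k n (compSubConstCLM ℂ x f) ≤
      (1 + ‖x‖) ^ k * (2 ^ k * (Finset.Iic (k, n)).sup (schwartzSeminormFamily ℂ V ℂ) f) := by
  refine SchwartzMap.seminorm_le_bound ℂ k n _ (by positivity) fun y => ?_
  have h1 : iteratedFDeriv ℝ n (compSubConstCLM ℂ x f) y = iteratedFDeriv ℝ n f (y - x) :=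
    iteratedFDeriv_comp_sub n x y
  have h2 : ‖y‖ ≤ (1 + ‖x‖) * (1 + ‖y - x‖) := by
    have : ‖y‖ ≤ ‖y - x‖ + ‖x‖ := by simpa using norm_add_le (y - x) x
    nlinarith [norm_nonneg x, norm_nonneg (y - x), mul_nonneg (norm_nonneg x) (norm_nonneg (y - x))]
  have h3 : (1 + ‖y - x‖) ^ k * ‖iteratedFDeriv ℝ n f (y - x)‖ ≤
      2 ^ k * (Finset.Iic (k, n)).sup (schwartzSeminormFamily ℂ V ℂ) f :=
    SchwartzMap.one_add_le_sup_seminorm_apply (𝕜 := ℂ) (m := (k, n)) le_rfl le_rfl f (y - x)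
  rw [h1]
  calc ‖y‖ ^ k * ‖iteratedFDeriv ℝ n f (y - x)‖
      ≤ ((1 + ‖x‖) * (1 + ‖y - x‖)) ^ k * ‖iteratedFDeriv ℝ n f (y - x)‖ := by gcongr
    _ = (1 + ‖x‖) ^ k * ((1 + ‖y - x‖) ^ k * ‖iteratedFDeriv ℝ n f (y - x)‖) := by
        rw [mul_pow]; ring
    _ ≤ _ := by gcongr

/-- Translations are polynomially bounded on `𝓢`. -/
theorem exists_seminorm_compSubConst_le (q : Seminorm ℂ 𝓢(V, ℂ)) (hq : Continuous q) :
    ∃ q' : Seminorm ℂ 𝓢(V, ℂ), Continuous q' ∧ ∃ N : ℕ, ∀ x f,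
      q (compSubConstCLM ℂ x f) ≤ (1 + ‖x‖) ^ N * q' f := by
  obtain ⟨m, C, h⟩ := exists_le_sup_Iic q hq
  refine ⟨(C * 2 ^ m.1 : NNReal) •
    (Finset.Iic m).sup (schwartzSeminormFamily ℂ V ℂ), ?_, m.1, fun x f => (h _).trans ?_⟩
  · exact (continuous_finset_sup_schwartzSeminormFamily _).const_smul
      (C * 2 ^ m.1 : NNReal)
  · rw [smul_apply, NNReal.smul_def, smul_eq_mul]
    push_cast
    have : (Finset.Iic m).sup (schwartzSeminormFamily ℂ V ℂ) (compSubConstCLM ℂ x f) ≤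
        (1 + ‖x‖) ^ m.1 * (2 ^ m.1 * (Finset.Iic m).sup (schwartzSeminormFamily ℂ V ℂ) f) := by
      refine Seminorm.finset_sup_apply_le (by positivity) fun i hi => ?_
      have hi' : i ≤ m := Finset.mem_Iic.mp hi
      refine (seminorm_compSubConst_le i.1 i.2 x f).trans ?_
      have h1 : (Finset.Iic i).sup (schwartzSeminormFamily ℂ V ℂ) f
          ≤ (Finset.Iic m).sup (schwartzSeminormFamily ℂ V ℂ) f :=
        Finset.sup_mono (f := schwartzSeminormFamily ℂ V ℂ) (Finset.Iic_subset_Iic.mpr hi') f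
      have h2 : (1 + ‖x‖) ^ i.1 ≤ (1 + ‖x‖) ^ m.1 :=
        pow_le_pow_right₀ (by linarith [norm_nonneg x]) hi'.1
      have h3 : (2 : ℝ) ^ i.1 ≤ 2 ^ m.1 := pow_le_pow_right₀ (by norm_num) hi'.1
      gcongr
    calc C * (Finset.Iic m).sup (schwartzSeminormFamily ℂ V ℂ) (compSubConstCLM ℂ x f)
        ≤ C * _ := mul_le_mul_of_nonneg_left this C.2
      _ = _ := by ring

/-- The mean value inequality on the segment from `y` to `y - h` costs one derivative, hence the
index `n + 1`. The condition `‖h‖ ≤ 1` keeps `‖y‖` comparable with the points of that segment.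
Linearity in `‖h‖` is what gives continuity of translation at `0`. -/
theorem seminorm_compSubConst_sub_le (k n : ℕ) (h : V) (hh : ‖h‖ ≤ 1) (f : 𝓢(V, ℂ)) :
    SchwartzMap.seminorm ℂ k n (compSubConstCLM ℂ h f - f) ≤
      (2 ^ k * (2 ^ k * (Finset.Iic (k, n + 1)).sup (schwartzSeminormFamily ℂ V ℂ) f)) * ‖h‖ := by
  set S := (Finset.Iic (k, n + 1)).sup (schwartzSeminormFamily ℂ V ℂ) f with hS
  refine SchwartzMap.seminorm_le_bound ℂ k n _ (by positivity) fun y => ?_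
  have h1 : iteratedFDeriv ℝ n (compSubConstCLM ℂ h f - f : 𝓢(V, ℂ)) y
      = iteratedFDeriv ℝ n f (y - h) - iteratedFDeriv ℝ n f y := by
    have : ⇑(compSubConstCLM ℂ h f - f : 𝓢(V, ℂ)) = (compSubConstCLM ℂ h f : V → ℂ) - f := by
      ext; simp
    rw [this, iteratedFDeriv_sub_apply ((SchwartzMap.smooth _ n).contDiffAt)
      ((SchwartzMap.smooth _ n).contDiffAt)]
    congr 1
    exact iteratedFDeriv_comp_sub n h y
  have hseg : ∀ t ∈ segment ℝ y (y - h), ‖y‖ ^ k * ‖iteratedFDeriv ℝ (n + 1) f t‖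
      ≤ 2 ^ k * (2 ^ k * S) := by
    intro t ht
    have hty : ‖y - t‖ ≤ ‖h‖ := by
      rw [segment_eq_image'] at ht
      obtain ⟨θ, hθ, rfl⟩ := ht
      have : y - (y + θ • (y - h - y)) = θ • h := by
        simp
      rw [this, norm_smul, Real.norm_of_nonneg hθ.1]
      exact mul_le_of_le_one_left (norm_nonneg _) hθ.2
    have h2 : ‖y‖ ≤ 2 * (1 + ‖t‖) := by
      have : ‖y‖ ≤ ‖y - t‖ + ‖t‖ := by simpa using norm_add_le (y - t) t
      linarith [norm_nonneg t]
    have h3 : (1 + ‖t‖) ^ k * ‖iteratedFDeriv ℝ (n + 1) f t‖ ≤ 2 ^ k * S :=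
      SchwartzMap.one_add_le_sup_seminorm_apply (𝕜 := ℂ) (m := (k, n + 1)) le_rfl le_rfl f t
    calc ‖y‖ ^ k * ‖iteratedFDeriv ℝ (n + 1) f t‖
        ≤ (2 * (1 + ‖t‖)) ^ k * ‖iteratedFDeriv ℝ (n + 1) f t‖ := by gcongr
      _ = 2 ^ k * ((1 + ‖t‖) ^ k * ‖iteratedFDeriv ℝ (n + 1) f t‖) := by rw [mul_pow]; ring
      _ ≤ _ := by gcongr
  have hmv := Convex.norm_image_sub_le_of_norm_fderiv_le (𝕜 := ℝ)
    (f := fun t => (‖y‖ ^ k) • iteratedFDeriv ℝ n f t) (s := segment ℝ y (y - h))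
    (C := 2 ^ k * (2 ^ k * S)) (x := y) (y := y - h)
    (fun t _ => (((f.smooth ⊤).differentiable_iteratedFDeriv
      (mod_cast WithTop.coe_lt_top n)) t).fun_const_smul _)
    (fun t ht => by
      rw [fderiv_fun_const_smul ((f.smooth ⊤).differentiable_iteratedFDeriv
        (mod_cast WithTop.coe_lt_top n) t), norm_smul, norm_fderiv_iteratedFDeriv, norm_pow, norm_norm]
      exact hseg t ht)
    (convex_segment _ _) (left_mem_segment _ _ _) (right_mem_segment _ _ _)
  rw [h1]
  simpa [← smul_sub, norm_smul] using hmv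

theorem continuous_compSubConst (f : 𝓢(V, ℂ)) :
    Continuous fun x : V => compSubConstCLM ℂ x f := by
  have h0 : Filter.Tendsto (fun h : V => compSubConstCLM ℂ h f) (nhds 0) (nhds f) := by
    rw [(schwartz_withSeminorms ℂ V ℂ).tendsto_nhds]
    intro i ε hε
    set C := 2 ^ i.1 * (2 ^ i.1 * (Finset.Iic (i.1, i.2 + 1)).sup (schwartzSeminormFamily ℂ V ℂ) f)
    have ht : Filter.Tendsto (fun h : V => C * ‖h‖) (nhds 0) (nhds 0) := by
      have : Continuous fun h : V => C * ‖h‖ := by fun_prop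
      simpa using this.tendsto 0
    filter_upwards [ht.eventually (gt_mem_nhds hε), Metric.closedBall_mem_nhds (0 : V) one_pos]
      with h h1 h2
    exact (seminorm_compSubConst_sub_le i.1 i.2 h (by simpa using h2) f).trans_lt h1
  refine continuous_iff_continuousAt.mpr fun x₀ => ?_
  have h1 : Filter.Tendsto (fun x : V => compSubConstCLM ℂ (x - x₀) f) (nhds x₀) (nhds f) :=
    h0.comp (by
      have : Continuous fun x : V => x - x₀ := by fun_prop
      simpa using this.tendsto x₀)
  have h2 := ((compSubConstCLM ℂ x₀ : 𝓢(V, ℂ) →L[ℂ] _).continuous.tendsto f).comp h1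
  refine h2.congr fun x => ?_
  simp

end SchwartzSeminorms

/-! ### Modulations and time-frequency shifts on the Schwartz space. -/

section TimeFreqShift

variable {V : Type*} [NormedAddCommGroup V] [InnerProductSpace ℝ V]

/-- The modulation `M_ξ f (y) = exp(i⟨y, ξ⟩) f(y)`. -/
def modulation (ξ : V) : 𝓢(V, ℂ) →L[ℂ] 𝓢(V, ℂ) :=
  SchwartzMap.smulLeftCLM ℂ (fun y : V => Complex.exp ((inner ℝ y ξ : ℝ) * Complex.I))

theorem modulation_apply (ξ : V) (f : 𝓢(V, ℂ)) (y : V) :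
    modulation ξ f y = Complex.exp ((inner ℝ y ξ : ℝ) * Complex.I) * f y := by
  simp [modulation, SchwartzMap.smulLeftCLM_apply_apply (hasTemperateGrowth_character ξ)]

theorem timeFreqShift_eq (x ξ : V) (f : 𝓢(V, ℂ)) :
    timeFreqShift x ξ f = modulation ξ (compSubConstCLM ℂ x f) := rfl

variable [FiniteDimensional ℝ V] [MeasurableSpace V] [BorelSpace V]

theorem fourier_compSubConst (x : V) (f : 𝓢(V, ℂ)) (ω : V) :
    𝓕 (compSubConstCLM ℂ x f) ω
      = Complex.exp ((-2 * Real.pi * inner ℝ x ω : ℝ) * Complex.I) * 𝓕 f ω := by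
  rw [fourier_coe, fourier_coe, Real.fourier_eq', Real.fourier_eq', ← integral_const_mul,
    ← integral_add_right_eq_self _ x]
  congr 1
  ext v
  simp only [compSubConstCLM_apply, add_sub_cancel_right, smul_eq_mul, ← mul_assoc,
    ← Complex.exp_add, inner_add_left]
  congr 2
  push_cast
  ring

theorem fourierInv_compSubConst (x : V) (f : 𝓢(V, ℂ)) (ω : V) :
    𝓕⁻ (compSubConstCLM ℂ x f) ω
      = Complex.exp ((2 * Real.pi * inner ℝ x ω : ℝ) * Complex.I) * 𝓕⁻ f ω := by
  rw [fourierInv_coe, fourierInv_coe, Real.fourierInv_eq', Real.fourierInv_eq',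
    ← integral_const_mul, ← integral_add_right_eq_self _ x]
  congr 1
  ext v
  simp only [compSubConstCLM_apply, add_sub_cancel_right, smul_eq_mul, ← mul_assoc,
    ← Complex.exp_add, inner_add_left]
  congr 2
  push_cast
  ring

/-- The Fourier transform conjugates modulation into translation, so bounds and continuity for
modulations are inherited from translations without differentiating the exponential. The factor
`(2π)⁻¹` reconciles the character `exp(i⟨y, ξ⟩)` with the normalisation of `𝓕`. -/
theorem modulation_eq_fourierInv (ξ : V) (f : 𝓢(V, ℂ)) :
    modulation ξ f = 𝓕⁻ (compSubConstCLM ℂ ((2 * Real.pi)⁻¹ • ξ) (𝓕 f)) := by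
  ext y
  rw [fourierInv_compSubConst, modulation_apply, FourierPair.fourierInv_fourier_eq,
    inner_smul_left, real_inner_comm]
  congr 3
  simp only [conj_trivial]
  congr 1
  field_simp

/-- Modulations are polynomially bounded on `𝓢`. -/
theorem exists_seminorm_modulation_le (q : Seminorm ℂ 𝓢(V, ℂ)) (hq : Continuous q) :
    ∃ q' : Seminorm ℂ 𝓢(V, ℂ), Continuous q' ∧ ∃ N : ℕ, ∀ ξ f,
      q (modulation ξ f) ≤ (1 + ‖ξ‖) ^ N * q' f := by
  obtain ⟨q', hq', N, h⟩ := exists_seminorm_compSubConst_le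
    (q.comp (fourierInvCLM ℂ 𝓢(V, ℂ) : 𝓢(V, ℂ) →L[ℂ] 𝓢(V, ℂ)).toLinearMap)
    (hq.comp (fourierInvCLM ℂ 𝓢(V, ℂ) : 𝓢(V, ℂ) →L[ℂ] 𝓢(V, ℂ)).continuous)
  refine ⟨q'.comp (fourierCLM ℂ 𝓢(V, ℂ) : 𝓢(V, ℂ) →L[ℂ] 𝓢(V, ℂ)).toLinearMap,
    hq'.comp (fourierCLM ℂ 𝓢(V, ℂ) : 𝓢(V, ℂ) →L[ℂ] 𝓢(V, ℂ)).continuous, N, fun ξ f => ?_⟩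
  rw [modulation_eq_fourierInv]
  refine (h ((2 * Real.pi)⁻¹ • ξ) (𝓕 f)).trans ?_
  have h1 : ‖(2 * Real.pi)⁻¹ • ξ‖ ≤ ‖ξ‖ := by
    rw [norm_smul]
    refine mul_le_of_le_one_left (norm_nonneg _) ?_
    rw [Real.norm_of_nonneg (by positivity)]
    exact inv_le_one_of_one_le₀ (by linarith [Real.pi_gt_three])
  change _ * q' (𝓕 f) ≤ _ * q' (𝓕 f)
  gcongr

/-- The polynomial weight `(1 + |x|) (1 + |ξ|)` on phase space. -/
def weight {V W : Type*} [Norm V] [Norm W] (z : V × W) : ℝ := (1 + ‖z.1‖) * (1 + ‖z.2‖)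

theorem exists_seminorm_timeFreqShift_le (q : Seminorm ℂ 𝓢(V, ℂ)) (hq : Continuous q) :
    ∃ q' : Seminorm ℂ 𝓢(V, ℂ), Continuous q' ∧ ∃ N : ℕ, ∀ (z : V × V) f,
      q (timeFreqShift z.1 z.2 f) ≤ weight z ^ N * q' f := by
  obtain ⟨q₁, hq₁, N₁, h₁⟩ := exists_seminorm_modulation_le q hq
  obtain ⟨q₂, hq₂, N₂, h₂⟩ := exists_seminorm_compSubConst_le q₁ hq₁
  refine ⟨q₂, hq₂, N₁ + N₂, fun z f => ?_⟩
  have ha : 1 ≤ 1 + ‖z.1‖ := by linarith [norm_nonneg z.1]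
  have hb : 1 ≤ 1 + ‖z.2‖ := by linarith [norm_nonneg z.2]
  have hf := apply_nonneg q₂ f
  rw [timeFreqShift_eq, weight, mul_pow]
  calc _ ≤ (1 + ‖z.2‖) ^ N₁ * ((1 + ‖z.1‖) ^ N₂ * q₂ f) :=
        (h₁ _ _).trans (mul_le_mul_of_nonneg_left (h₂ _ _) (by positivity))
    _ ≤ (1 + ‖z.2‖) ^ (N₁ + N₂) * ((1 + ‖z.1‖) ^ (N₁ + N₂) * q₂ f) := by
        gcongr <;> first | assumption | omega
    _ = _ := by ring

theorem continuous_modulation (f : 𝓢(V, ℂ)) : Continuous fun ξ : V => modulation ξ f := by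
  simp only [modulation_eq_fourierInv]
  exact (fourierInvCLM ℂ 𝓢(V, ℂ) : 𝓢(V, ℂ) →L[ℂ] 𝓢(V, ℂ)).continuous.comp
    ((continuous_compSubConst (𝓕 f)).comp (by fun_prop))

theorem continuous_timeFreqShift (f : 𝓢(V, ℂ)) :
    Continuous fun z : V × V => timeFreqShift z.1 z.2 f := by
  refine continuous_iff_continuousAt.mpr fun z₀ => ?_
  have h1 : Filter.Tendsto (fun z : V × V => modulation z.2 (compSubConstCLM ℂ z₀.1 f))
      (nhds z₀) (nhds (timeFreqShift z₀.1 z₀.2 f)) :=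
    ((continuous_modulation (compSubConstCLM ℂ z₀.1 f)).comp continuous_snd).tendsto z₀
  -- Separate continuity is not enough for joint continuity. The error term vanishes because
  -- modulations are bounded on seminorms locally uniformly in the frequency.
  have h2 : Filter.Tendsto (fun z : V × V =>
      modulation z.2 (compSubConstCLM ℂ z.1 f - compSubConstCLM ℂ z₀.1 f)) (nhds z₀) (nhds 0) := by
    rw [(schwartz_withSeminorms ℂ V ℂ).tendsto_nhds]
    intro i ε hε
    obtain ⟨q', hq', N, h⟩ := exists_seminorm_modulation_le (schwartzSeminormFamily ℂ V ℂ i)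
      ((schwartz_withSeminorms ℂ V ℂ).continuous_seminorm i)
    have hc : Continuous fun z : V × V => (1 + ‖z.2‖) ^ N *
        q' (compSubConstCLM ℂ z.1 f - compSubConstCLM ℂ z₀.1 f) :=
      (by fun_prop : Continuous fun z : V × V => (1 + ‖z.2‖) ^ N).mul
        (hq'.comp (((continuous_compSubConst f).comp continuous_fst).sub continuous_const))
    have ht := hc.tendsto z₀
    simp only [sub_self, map_zero, mul_zero] at ht
    filter_upwards [ht.eventually (gt_mem_nhds hε)] with z hz
    rw [sub_zero]
    exact (h _ _).trans_lt hz
  have h3 := h1.add h2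
  rw [add_zero] at h3
  refine h3.congr fun z => ?_
  rw [timeFreqShift_eq, map_sub]
  abel

end TimeFreqShift

end GaborWF

end

noncomputable section

namespace GaborWF

/-! ### Integrals of Schwartz-valued families, and functionals under the integral sign. -/

section SchwartzIntegral

variable {V : Type*} [NormedAddCommGroup V] [NormedSpace ℝ V]
  {Z : Type*} [TopologicalSpace Z]

theorem iteratedFDeriv_sub_schwartz (n : ℕ) (f g : 𝓢(V, ℂ)) (y : V) :
    iteratedFDeriv ℝ n (f - g : 𝓢(V, ℂ)) y = iteratedFDeriv ℝ n f y - iteratedFDeriv ℝ n g y := by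
  have : ⇑(f - g : 𝓢(V, ℂ)) = (f : V → ℂ) - g := by ext; simp
  rw [this, iteratedFDeriv_sub_apply ((SchwartzMap.smooth _ n).contDiffAt)
    ((SchwartzMap.smooth _ n).contDiffAt)]

theorem continuous_iteratedFDeriv_apply {Θ : Z → 𝓢(V, ℂ)} (hΘ : Continuous Θ) (n : ℕ) (y : V) :
    Continuous fun z => iteratedFDeriv ℝ n (Θ z) y := by
  refine continuous_iff_continuousAt.mpr fun z₀ => ?_
  have h := (schwartz_withSeminorms ℂ V ℂ).tendsto_nhds Θ (Θ z₀) |>.mp (hΘ.tendsto z₀) (0, n)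
  refine Metric.tendsto_nhds.mpr fun ε hε => ?_
  filter_upwards [h ε hε] with z hz
  rw [dist_eq_norm, ← iteratedFDeriv_sub_schwartz]
  exact (SchwartzMap.norm_iteratedFDeriv_le_seminorm ℂ _ n y).trans_lt hz

variable [SecondCountableTopology Z] [MeasurableSpace Z] [OpensMeasurableSpace Z]
  {μ : Measure Z} {Θ : Z → 𝓢(V, ℂ)}

theorem integrable_iteratedFDeriv (hΘ : Continuous Θ)
    (hint : ∀ k n, Integrable (fun z => SchwartzMap.seminorm ℂ k n (Θ z)) μ) (n : ℕ) (y : V) :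
    Integrable (fun z => iteratedFDeriv ℝ n (Θ z) y) μ :=
  (hint 0 n).mono' (continuous_iteratedFDeriv_apply hΘ n y).aestronglyMeasurable
    (.of_forall fun z => SchwartzMap.norm_iteratedFDeriv_le_seminorm ℂ (Θ z) n y)

/-- Differentiation under the integral at every order: the seminorm `(0, n + 1)` of `Θ z` dominates
the derivative of order `n + 1` uniformly in `y` and is integrable in `z`. -/
theorem hasFTaylorSeriesUpTo_integral (hΘ : Continuous Θ)
    (hint : ∀ k n, Integrable (fun z => SchwartzMap.seminorm ℂ k n (Θ z)) μ) :
    HasFTaylorSeriesUpTo (⊤ : ℕ∞) (fun y => ∫ z, Θ z y ∂μ)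
      (fun y n => ∫ z, iteratedFDeriv ℝ n (Θ z) y ∂μ) := by
  have key : ∀ (n : ℕ) (y : V), HasFDerivAt (fun y => ∫ z, iteratedFDeriv ℝ n (Θ z) y ∂μ)
      (∫ z, iteratedFDeriv ℝ (n + 1) (Θ z) y ∂μ).curryLeft y := by
    intro n y
    have hF' : ∀ z y, fderiv ℝ (iteratedFDeriv ℝ n (Θ z)) y
        = (continuousMultilinearCurryLeftEquiv ℝ (fun _ : Fin (n + 1) => V) ℂ)
          (iteratedFDeriv ℝ (n + 1) (Θ z) y) := by
      intro z y
      rw [iteratedFDeriv_succ_eq_comp_left]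
      simp
    have h := hasFDerivAt_integral_of_dominated_of_fderiv_le (𝕜 := ℝ) (μ := μ)
      (F := fun y z => iteratedFDeriv ℝ n (Θ z) y)
      (F' := fun y z => fderiv ℝ (iteratedFDeriv ℝ n (Θ z)) y) (x₀ := y) (s := Set.univ)
      (bound := fun z => SchwartzMap.seminorm ℂ 0 (n + 1) (Θ z)) Filter.univ_mem
      (.of_forall fun y => (continuous_iteratedFDeriv_apply hΘ n y).aestronglyMeasurable)
      (integrable_iteratedFDeriv hΘ hint n y)
      (by
        simp only [hF']
        exact ((LinearIsometryEquiv.continuous _).comp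
          (continuous_iteratedFDeriv_apply hΘ (n + 1) y)).aestronglyMeasurable)
      (.of_forall fun z y _ => by
        rw [norm_fderiv_iteratedFDeriv]
        exact SchwartzMap.norm_iteratedFDeriv_le_seminorm ℂ (Θ z) (n + 1) y)
      (hint 0 (n + 1))
      (.of_forall fun z y _ => (((Θ z).smooth ⊤).differentiable_iteratedFDeriv
        (mod_cast WithTop.coe_lt_top n) y).hasFDerivAt)
    have e : ∫ z, fderiv ℝ (iteratedFDeriv ℝ n (Θ z)) y ∂μ
        = (∫ z, iteratedFDeriv ℝ (n + 1) (Θ z) y ∂μ).curryLeft := by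
      rw [integral_congr_ae (.of_forall fun z => hF' z y)]
      exact ContinuousLinearMap.integral_comp_comm (𝕜 := ℝ) (E := V [×(n + 1)]→L[ℝ] ℂ)
        (Fₗ := V →L[ℝ] V [×n]→L[ℝ] ℂ) (continuousMultilinearCurryLeftEquiv ℝ
          (fun _ : Fin (n + 1) => V) ℂ).toContinuousLinearEquiv.toContinuousLinearMap
        (integrable_iteratedFDeriv hΘ hint (n + 1) y)
    exact e ▸ h
  refine ⟨fun y => ?_, fun n _ y => key n y, fun n _ => ?_⟩
  · change (continuousMultilinearCurryFin0 ℝ V ℂ) (∫ z, iteratedFDeriv ℝ 0 (Θ z) y ∂μ) = _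
    refine ((continuousMultilinearCurryFin0 ℝ V
      ℂ).toContinuousLinearEquiv.toContinuousLinearMap.integral_comp_comm
      (integrable_iteratedFDeriv hΘ hint 0 y)).symm.trans ?_
    simp
  · exact continuous_iff_continuousAt.mpr fun y => (key n y).continuousAt

/-- The integral of a continuous family of Schwartz functions all of whose seminorms are
integrable. -/
def schwartzIntegral (μ : Measure Z) (Θ : Z → 𝓢(V, ℂ)) (hΘ : Continuous Θ)
    (hint : ∀ k n, Integrable (fun z => SchwartzMap.seminorm ℂ k n (Θ z)) μ) : 𝓢(V, ℂ) where
  toFun y := ∫ z, Θ z y ∂μ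
  smooth' := (hasFTaylorSeriesUpTo_integral hΘ hint).contDiff
  decay' k n := by
    refine ⟨∫ z, SchwartzMap.seminorm ℂ k n (Θ z) ∂μ, fun y => ?_⟩
    rw [← (hasFTaylorSeriesUpTo_integral hΘ hint).eq_iteratedFDeriv (mod_cast le_top),
      ← norm_norm y, ← norm_pow, ← norm_smul, ← integral_smul]
    refine norm_integral_le_of_norm_le (hint k n) (.of_forall fun z => ?_)
    rw [norm_smul, norm_pow, norm_norm]
    exact SchwartzMap.le_seminorm ℂ k n (Θ z) y

theorem schwartzIntegral_apply (hΘ : Continuous Θ)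
    (hint : ∀ k n, Integrable (fun z => SchwartzMap.seminorm ℂ k n (Θ z)) μ) (y : V) :
    schwartzIntegral μ Θ hΘ hint y = ∫ z, Θ z y ∂μ := rfl

theorem iteratedFDeriv_schwartzIntegral (hΘ : Continuous Θ)
    (hint : ∀ k n, Integrable (fun z => SchwartzMap.seminorm ℂ k n (Θ z)) μ) (n : ℕ) (y : V) :
    iteratedFDeriv ℝ n (schwartzIntegral μ Θ hΘ hint) y
      = ∫ z, iteratedFDeriv ℝ n (Θ z) y ∂μ :=
  ((hasFTaylorSeriesUpTo_integral hΘ hint).eq_iteratedFDeriv (mod_cast le_top) y).symm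

theorem seminorm_schwartzIntegral_le (hΘ : Continuous Θ)
    (hint : ∀ k n, Integrable (fun z => SchwartzMap.seminorm ℂ k n (Θ z)) μ) (k n : ℕ) :
    SchwartzMap.seminorm ℂ k n (schwartzIntegral μ Θ hΘ hint)
      ≤ ∫ z, SchwartzMap.seminorm ℂ k n (Θ z) ∂μ := by
  refine SchwartzMap.seminorm_le_bound ℂ k n _ (integral_nonneg fun z => apply_nonneg _ _)
    fun y => ?_
  rw [iteratedFDeriv_schwartzIntegral, ← norm_norm y, ← norm_pow, ← norm_smul, ← integral_smul]
  refine norm_integral_le_of_norm_le (hint k n) (.of_forall fun z => ?_)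
  rw [norm_smul, norm_pow, norm_norm]
  exact SchwartzMap.le_seminorm ℂ k n (Θ z) y

/-- The value of the normalised weighted derivative
`|y|ᵏ Dⁿf(y)(m₀, …, mₙ₋₁) / (|m₀| ⋯ |mₙ₋₁|)`, where `i = (k, n)`. -/
def jetCoord (i : ℕ × ℕ) (y : V) (m : ℕ → V) : 𝓢(V, ℂ) →ₗ[ℂ] ℂ where
  toFun f := ((‖y‖ ^ i.1 / ∏ j : Fin i.2, ‖m j‖ : ℝ) : ℂ) *
    iteratedFDeriv ℝ i.2 f y (fun j => m j)
  map_add' f g := by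
    have : ⇑(f + g : 𝓢(V, ℂ)) = (f : V → ℂ) + g := by ext; simp
    rw [this, iteratedFDeriv_add_apply ((f.smooth i.2).contDiffAt) ((g.smooth i.2).contDiffAt),
      add_apply, mul_add]
  map_smul' c f := by
    have : ⇑(c • f : 𝓢(V, ℂ)) = c • (f : V → ℂ) := by ext; simp
    rw [this, iteratedFDeriv_const_smul_apply ((f.smooth i.2).contDiffAt),
      smul_apply, smul_eq_mul, RingHom.id_apply, smul_eq_mul]
    ring

theorem jetCoord_apply (i : ℕ × ℕ) (y : V) (m : ℕ → V) (f : 𝓢(V, ℂ)) :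
    jetCoord i y m f = ((‖y‖ ^ i.1 / ∏ j : Fin i.2, ‖m j‖ : ℝ) : ℂ) *
      iteratedFDeriv ℝ i.2 f y (fun j => m j) := rfl

theorem norm_jetCoord_le (i : ℕ × ℕ) (y : V) (m : ℕ → V) (f : 𝓢(V, ℂ)) :
    ‖jetCoord i y m f‖ ≤ schwartzSeminormFamily ℂ V ℂ i f := by
  have hP : 0 ≤ ∏ j : Fin i.2, ‖m j‖ := Finset.prod_nonneg fun _ _ => norm_nonneg _
  rw [jetCoord_apply, norm_mul, Complex.norm_real, Real.norm_of_nonneg (by positivity)]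
  calc ‖y‖ ^ i.1 / (∏ j : Fin i.2, ‖m j‖) * ‖iteratedFDeriv ℝ i.2 f y (fun j => m j)‖
      ≤ ‖y‖ ^ i.1 / (∏ j : Fin i.2, ‖m j‖) *
        (‖iteratedFDeriv ℝ i.2 f y‖ * ∏ j : Fin i.2, ‖m j‖) := by
        gcongr
        exact ContinuousMultilinearMap.le_opNorm _ _
    _ = (‖y‖ ^ i.1 * ‖iteratedFDeriv ℝ i.2 f y‖) *
        ((∏ j : Fin i.2, ‖m j‖) / ∏ j : Fin i.2, ‖m j‖) := by ring
    _ ≤ (‖y‖ ^ i.1 * ‖iteratedFDeriv ℝ i.2 f y‖) * 1 := by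
        gcongr
        exact div_self_le_one _
    _ ≤ _ := by
        rw [mul_one]
        exact SchwartzMap.le_seminorm ℂ i.1 i.2 f y

/-- Together with `norm_jetCoord_le`, this exhibits a Schwartz seminorm as a supremum of moduli of
linear functionals, so that finitely many seminorms become the norm of an element of an `ℓ^∞` space.
-/
theorem seminorm_le_of_jetCoord_le (i : ℕ × ℕ) (f : 𝓢(V, ℂ)) {B : ℝ} (hB : 0 ≤ B)
    (h : ∀ y m, ‖jetCoord i y m f‖ ≤ B) : schwartzSeminormFamily ℂ V ℂ i f ≤ B := by
  refine SchwartzMap.seminorm_le_bound ℂ _ _ _ hB fun y => ?_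
  rw [← norm_norm y, ← norm_pow, ← norm_smul]
  refine ContinuousMultilinearMap.opNorm_le_bound hB fun m => ?_
  rw [smul_apply, norm_smul, norm_pow, norm_norm]
  by_cases hm : ∀ j, m j ≠ 0
  · have hP : 0 < ∏ j, ‖m j‖ := Finset.prod_pos fun j _ => norm_pos_iff.mpr (hm j)
    -- Only the first `i.2` entries of the sequence are read, so the padding by `0` is arbitrary.
    -- Sequences indexed by `ℕ` keep the index type of the jets independent of the order.
    have h1 := h y (fun j => if hj : j < i.2 then m ⟨j, hj⟩ else 0)
    rw [jetCoord_apply, norm_mul, Complex.norm_real] at h1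
    simp only [Fin.is_lt, dite_true, Fin.eta] at h1
    rw [Real.norm_of_nonneg (by positivity), div_mul_eq_mul_div, div_le_iff₀ hP] at h1
    exact h1
  · push Not at hm
    obtain ⟨j, hj⟩ := hm
    rw [ContinuousMultilinearMap.map_coord_zero _ j hj, norm_zero, mul_zero]
    exact mul_nonneg hB (Finset.prod_nonneg fun _ _ => norm_nonneg _)

/-- The jet map of `𝓢` into a space of bounded functions; its norm is the seminorm attached to the
finite set `s`. -/
def jet (s : Finset (ℕ × ℕ)) :
    𝓢(V, ℂ) →ₗ[ℂ] lp (fun _ : s × V × (ℕ → V) => ℂ) ⊤ where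
  toFun f := ⟨fun x => jetCoord x.1 x.2.1 x.2.2 f, memℓp_infty
    ⟨s.sup (schwartzSeminormFamily ℂ V ℂ) f, by
      rintro _ ⟨x, rfl⟩
      exact (norm_jetCoord_le _ _ _ f).trans
        (Finset.le_sup (f := schwartzSeminormFamily ℂ V ℂ) x.1.2 f)⟩⟩
  map_add' f g := by
    ext x
    exact map_add (jetCoord x.1 x.2.1 x.2.2) f g
  map_smul' c f := by
    ext x
    exact map_smul (jetCoord x.1 x.2.1 x.2.2) c f

theorem jet_apply (s : Finset (ℕ × ℕ)) (f : 𝓢(V, ℂ)) (x : s × V × (ℕ → V)) :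
    jet s f x = jetCoord x.1 x.2.1 x.2.2 f := rfl

theorem norm_jet (s : Finset (ℕ × ℕ)) (f : 𝓢(V, ℂ)) :
    ‖jet s f‖ = s.sup (schwartzSeminormFamily ℂ V ℂ) f := by
  refine le_antisymm ?_ ?_
  · refine lp.norm_le_of_forall_le (apply_nonneg _ _) fun x => ?_
    exact (norm_jetCoord_le _ _ _ f).trans
      (Finset.le_sup (f := schwartzSeminormFamily ℂ V ℂ) x.1.2 f)
  · refine Seminorm.finset_sup_apply_le (norm_nonneg _) fun i hi => ?_
    exact seminorm_le_of_jetCoord_le i f (norm_nonneg _) fun y m =>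
      lp.norm_apply_le_norm ENNReal.top_ne_zero (jet s f) (⟨i, hi⟩, y, m)

theorem continuous_jet (s : Finset (ℕ × ℕ)) : Continuous (jet (V := V) s) := by
  refine (schwartz_withSeminorms ℂ V ℂ).continuous_normedSpace_rng _ (jet s) ⟨s, 1, fun f => ?_⟩
  rw [one_smul]
  exact (norm_jet s f).le

/-- Every continuous functional on `𝓢` factors through a jet map. -/
theorem exists_eq_comp_jet (u : 𝓢(V, ℂ) →L[ℂ] ℂ) :
    ∃ (s : Finset (ℕ × ℕ)) (v : lp (fun _ : s × V × (ℕ → V) => ℂ) ⊤ →L[ℂ] ℂ),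
      ∀ f, u f = v (jet s f) := by
  obtain ⟨s, C, -, h⟩ := Seminorm.bound_of_continuous (schwartz_withSeminorms ℂ V ℂ)
    ((normSeminorm ℂ ℂ).comp u.toLinearMap) (continuous_norm.comp u.continuous)
  have hu : ∀ f, ‖u f‖ ≤ C * ‖jet s f‖ := fun f => by
    rw [norm_jet]
    exact h f
  -- The bound forces `u` to vanish where the jet map does, so `u` descends to its range.
  -- Hahn–Banach then extends it to the whole `ℓ^∞` space.
  have hker : LinearMap.ker (jet s) ≤ LinearMap.ker (u : 𝓢(V, ℂ) →ₗ[ℂ] ℂ) := fun f hf => by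
    have := hu f
    rw [LinearMap.mem_ker.mp hf, norm_zero, mul_zero] at this
    exact norm_le_zero_iff.mp this
  let e := (jet (V := V) s).quotKerEquivRange
  let w : LinearMap.range (jet (V := V) s) →ₗ[ℂ] ℂ :=
    (LinearMap.ker (jet s)).liftQ (u : 𝓢(V, ℂ) →ₗ[ℂ] ℂ) hker ∘ₗ e.symm.toLinearMap
  have hw : ∀ f, w ⟨jet s f, LinearMap.mem_range_self _ f⟩ = u f := fun f => by
    have : e.symm ⟨jet s f, LinearMap.mem_range_self _ f⟩ = Submodule.Quotient.mk f := by
      rw [LinearEquiv.symm_apply_eq]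
      rfl
    simp only [w, LinearMap.comp_apply, LinearEquiv.coe_coe, this]
    rfl
  obtain ⟨v, hv, -⟩ := exists_extension_norm_eq (LinearMap.range (jet (V := V) s))
    (w.mkContinuous C fun x => by
      obtain ⟨_, f, rfl⟩ := x
      rw [hw]
      exact hu f)
  exact ⟨s, v, fun f => by
    rw [← hw f]
    exact (hv ⟨jet s f, LinearMap.mem_range_self _ f⟩).symm⟩

/-- Continuous functionals commute with Schwartz-valued integrals. -/
theorem integrable_continuousLinearMap_comp (u : 𝓢(V, ℂ) →L[ℂ] ℂ) (hΘ : Continuous Θ)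
    (hint : ∀ k n, Integrable (fun z => SchwartzMap.seminorm ℂ k n (Θ z)) μ) :
    Integrable (fun z => u (Θ z)) μ ∧ u (schwartzIntegral μ Θ hΘ hint) = ∫ z, u (Θ z) ∂μ := by
  obtain ⟨s, v, hv⟩ := exists_eq_comp_jet u
  have hJ : Integrable (fun z => jet s (Θ z)) μ := by
    refine Integrable.mono' (g := fun z => ∑ i ∈ s, schwartzSeminormFamily ℂ V ℂ i (Θ z))
      (integrable_finsetSum _ fun i _ => hint i.1 i.2)
      ((continuous_jet s).comp hΘ).aestronglyMeasurable (.of_forall fun z => ?_)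
    rw [norm_jet]
    have := Seminorm.finset_sup_le_sum (schwartzSeminormFamily ℂ V ℂ) s (Θ z)
    simpa using this
  -- The identity is checked coordinatewise: evaluation at an index is continuous on `ℓ^∞`, and each
  -- coordinate is a scaled derivative at one point, which commutes with the pointwise integral.
  have hg : jet s (schwartzIntegral μ Θ hΘ hint) = ∫ z, jet s (Θ z) ∂μ := by
    ext x
    have h1 : (∫ z, jet s (Θ z) ∂μ) x = ∫ z, jet s (Θ z) x ∂μ :=
      ((lp.evalCLM ℂ (fun _ : s × V × (ℕ → V) => ℂ) ⊤ x).integral_comp_comm hJ).symm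
    rw [h1]
    simp only [jet_apply, jetCoord_apply]
    rw [integral_const_mul, iteratedFDeriv_schwartzIntegral,
      ContinuousMultilinearMap.integral_apply (integrable_iteratedFDeriv hΘ hint _ _)]
  simp only [hv]
  exact ⟨v.integrable_comp hJ, by rw [hg, v.integral_comp_comm hJ]⟩

end SchwartzIntegral

end GaborWF

end

noncomputable section

namespace GaborWF

open FourierTransform

/-! ### Polynomial weights on phase space. -/

section Weight

variable {V : Type*} [NormedAddCommGroup V]

theorem one_le_one_add_norm (x : V) : 1 ≤ 1 + ‖x‖ := by linarith [norm_nonneg x]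

theorem one_add_norm_add_le (x y : V) : 1 + ‖x + y‖ ≤ (1 + ‖x‖) * (1 + ‖y‖) := by
  nlinarith [norm_add_le x y, norm_nonneg x, norm_nonneg y]

variable {W : Type*} [NormedAddCommGroup W]

theorem one_le_weight (z : V × W) : 1 ≤ weight z :=
  one_le_mul_of_one_le_of_one_le (one_le_one_add_norm _) (one_le_one_add_norm _)

theorem weight_pos (z : V × W) : 0 < weight z := zero_lt_one.trans_le (one_le_weight z)

theorem continuous_weight : Continuous (weight : V × W → ℝ) := by
  unfold weight
  fun_prop

theorem weight_add_le (z w : V × W) : weight (z + w) ≤ weight z * weight w := by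
  have h1 := one_add_norm_add_le z.1 w.1
  have h2 := one_add_norm_add_le z.2 w.2
  calc weight (z + w) ≤ ((1 + ‖z.1‖) * (1 + ‖w.1‖)) * ((1 + ‖z.2‖) * (1 + ‖w.2‖)) := by
        unfold weight
        exact mul_le_mul h1 h2 (by positivity) (by positivity)
    _ = _ := by unfold weight; ring

theorem weight_neg (z : V × W) : weight (-z) = weight z := by simp [weight]

theorem weight_neg_snd (z : V × W) : weight (z.1, -z.2) = weight z := by simp [weight]

variable [NormedSpace ℝ V] [FiniteDimensional ℝ V] [MeasurableSpace V] [BorelSpace V]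
  [NormedSpace ℝ W] [FiniteDimensional ℝ W] [MeasurableSpace W] [BorelSpace W]

theorem exists_integrable_one_add_norm_pow (μ : Measure V) [μ.IsAddHaarMeasure] :
    ∃ D : ℕ, ∀ n, D ≤ n → Integrable (fun x : V => ((1 + ‖x‖) ^ n)⁻¹) μ := by
  refine ⟨Module.finrank ℝ V + 1, fun n hn => ?_⟩
  have h := integrable_one_add_norm (E := V) (μ := μ) (r := (n : ℝ)) (by
    exact_mod_cast (Nat.lt_of_succ_le hn))
  refine h.congr (.of_forall fun x => ?_)
  simp only
  rw [Real.rpow_neg (by positivity), Real.rpow_natCast]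

theorem exists_integrable_weight_pow (μ : Measure V) [μ.IsAddHaarMeasure]
    (ν : Measure W) [ν.IsAddHaarMeasure] :
    ∃ D : ℕ, ∀ n, D ≤ n → Integrable (fun z : V × W => (weight z ^ n)⁻¹) (μ.prod ν) := by
  obtain ⟨D₁, h₁⟩ := exists_integrable_one_add_norm_pow μ
  obtain ⟨D₂, h₂⟩ := exists_integrable_one_add_norm_pow ν
  refine ⟨max D₁ D₂, fun n hn => ?_⟩
  refine ((h₁ n (le_of_max_le_left hn)).mul_prod (h₂ n (le_of_max_le_right hn))).congr
    (.of_forall fun z => ?_)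
  simp [weight, mul_pow, mul_comm]

end Weight

/-! ### Polynomial growth and rapid decay of short-time Fourier transforms. -/

section STFT

variable {V : Type*} [NormedAddCommGroup V] [InnerProductSpace ℝ V]

/-- The normalising constant `(2π)^{-n/2}` of the short-time Fourier transform. -/
def stftConst (V : Type*) [NormedAddCommGroup V] [InnerProductSpace ℝ V] : ℝ :=
  (2 * Real.pi) ^ (-(Module.finrank ℝ V : ℝ) / 2)

theorem stftConst_pos : 0 < stftConst V := by
  unfold stftConst
  positivity

theorem stftConst_sq_mul : stftConst V ^ 2 * (2 * Real.pi) ^ Module.finrank ℝ V = 1 := by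
  have hpi : 0 < 2 * Real.pi := by positivity
  rw [stftConst, ← Real.rpow_natCast, ← Real.rpow_mul hpi.le, ← Real.rpow_natCast,
    ← Real.rpow_add hpi]
  convert Real.rpow_zero (2 * Real.pi)
  push_cast
  ring

theorem stft_eq (φ : 𝓢(V, ℂ)) (u : 𝓢'(V, ℂ)) (x ξ : V) :
    stft φ u x ξ = (stftConst V : ℂ) * pair u (timeFreqShift x ξ φ) := rfl

theorem conjS_conjS (φ : 𝓢(V, ℂ)) : conjS (conjS φ) = φ := by
  ext x
  simp [conjS_apply]

theorem conjS_timeFreqShift (x ξ : V) (φ : 𝓢(V, ℂ)) :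
    conjS (timeFreqShift x ξ φ) = timeFreqShift x (-ξ) (conjS φ) := by
  ext y
  rw [conjS_apply, timeFreqShift_apply, timeFreqShift_apply, conjS_apply, map_mul,
    ← Complex.exp_conj, map_mul, Complex.conj_ofReal, Complex.conj_I, inner_neg_right]
  push_cast
  ring_nf

theorem stft_eq_apply (φ : 𝓢(V, ℂ)) (u : 𝓢'(V, ℂ)) (x ξ : V) :
    stft φ u x ξ = (stftConst V : ℂ) * u (timeFreqShift x (-ξ) (conjS φ)) := by
  rw [stft_eq, pair, conjS_timeFreqShift]

theorem norm_timeFreqShift_apply (x ξ : V) (φ : 𝓢(V, ℂ)) (y : V) :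
    ‖timeFreqShift x ξ φ y‖ = ‖φ (y - x)‖ := by
  rw [timeFreqShift_apply, norm_mul, Complex.norm_exp_ofReal_mul_I, one_mul]

variable [FiniteDimensional ℝ V] [MeasurableSpace V] [BorelSpace V]

theorem continuous_stft (φ : 𝓢(V, ℂ)) (u : 𝓢'(V, ℂ)) :
    Continuous fun z : V × V => stft φ u z.1 z.2 := by
  simp only [stft_eq_apply]
  refine continuous_const.mul ((ContinuousLinearMap.continuous u).comp ?_)
  exact (continuous_timeFreqShift (conjS φ)).comp
    (by fun_prop : Continuous fun z : V × V => (z.1, -z.2))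

/-- The short-time Fourier transform of a tempered distribution grows polynomially. -/
theorem exists_norm_stft_le (φ : 𝓢(V, ℂ)) (u : 𝓢'(V, ℂ)) :
    ∃ (C : ℝ) (N : ℕ), 0 ≤ C ∧ ∀ z : V × V, ‖stft φ u z.1 z.2‖ ≤ C * weight z ^ N := by
  obtain ⟨q, -, N, h⟩ := exists_seminorm_timeFreqShift_le
    ((normSeminorm ℂ ℂ).comp (u : 𝓢(V, ℂ) →ₗ[ℂ] ℂ))
    (continuous_norm.comp (ContinuousLinearMap.continuous u))
  refine ⟨stftConst V * q (conjS φ), N, mul_nonneg stftConst_pos.le (apply_nonneg _ _),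
    fun z => ?_⟩
  rw [stft_eq_apply, norm_mul, Complex.norm_real, Real.norm_of_nonneg stftConst_pos.le]
  have := h (z.1, -z.2) (conjS φ)
  rw [weight_neg_snd] at this
  calc _ ≤ stftConst V * (weight z ^ N * q (conjS φ)) :=
        mul_le_mul_of_nonneg_left this stftConst_pos.le
    _ = _ := by ring

theorem pair_coe (f g : 𝓢(V, ℂ)) :
    pair (f : 𝓢'(V, ℂ)) g = ∫ y, (starRingEnd ℂ) (g y) * f y :=
  SchwartzMap.coe_apply f (conjS g)

/-- Since `1 + |x| ≤ (1 + |y - x|)(1 + |y|)`, the window absorbs one factor and `f` the other, with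
`D` further powers from `f` for integrability in `y`. Only the modulus of `b` enters, so the
estimate serves both the position side and the Fourier side. -/
theorem exists_seminorm_integral_mul_le (φ : 𝓢(V, ℂ)) (N : ℕ) :
    ∃ q : Seminorm ℂ 𝓢(V, ℂ), Continuous q ∧ ∀ (f : 𝓢(V, ℂ)) (x : V) (b : V → ℂ),
      (∀ y, ‖b y‖ = ‖φ (y - x)‖) → (1 + ‖x‖) ^ N * ‖∫ y, b y * f y‖ ≤ q f := by
  obtain ⟨D, hD⟩ := exists_integrable_one_add_norm_pow (volume : Measure V)
  set I := ∫ y : V, ((1 + ‖y‖) ^ D)⁻¹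
  have hI : 0 ≤ I := integral_nonneg fun y => by positivity
  set P : Seminorm ℂ 𝓢(V, ℂ) := (Finset.Iic (N, 0)).sup (schwartzSeminormFamily ℂ V ℂ)
  set Q : Seminorm ℂ 𝓢(V, ℂ) := (Finset.Iic (N + D, 0)).sup (schwartzSeminormFamily ℂ V ℂ)
  have hP : ∀ y, (1 + ‖y‖) ^ N * ‖φ y‖ ≤ 2 ^ N * P φ := fun y => by
    rw [← norm_iteratedFDeriv_zero (𝕜 := ℝ)]
    exact SchwartzMap.one_add_le_sup_seminorm_apply (𝕜 := ℂ) (m := (N, 0)) le_rfl le_rfl φ y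
  have hQ : ∀ (f : 𝓢(V, ℂ)) y, (1 + ‖y‖) ^ (N + D) * ‖f y‖ ≤ 2 ^ (N + D) * Q f := fun f y => by
    rw [← norm_iteratedFDeriv_zero (𝕜 := ℝ)]
    exact SchwartzMap.one_add_le_sup_seminorm_apply (𝕜 := ℂ) (m := (N + D, 0)) le_rfl le_rfl f y
  let c : NNReal := ⟨2 ^ N * P φ * (2 ^ (N + D)) * I, by positivity⟩
  refine ⟨c • Q, (continuous_finset_sup_schwartzSeminormFamily _).const_smul c,
    fun f x b hb => ?_⟩
  rw [smul_apply, NNReal.smul_def, smul_eq_mul]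
  have h1 : ‖∫ y, (((1 + ‖x‖) ^ N : ℝ) : ℂ) * (b y * f y)‖
      ≤ ∫ y : V, (2 ^ N * P φ * (2 ^ (N + D) * Q f)) * ((1 + ‖y‖) ^ D)⁻¹ := by
    refine norm_integral_le_of_norm_le ((hD D le_rfl).const_mul _) (.of_forall fun y => ?_)
    have hx : 1 + ‖x‖ ≤ (1 + ‖y - x‖) * (1 + ‖y‖) := by
      have := one_add_norm_add_le (-(y - x)) y
      rwa [norm_neg, neg_sub, sub_add_cancel] at this
    rw [norm_mul, norm_mul, Complex.norm_real, Real.norm_of_nonneg (by positivity), hb,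
      ← div_eq_mul_inv, le_div_iff₀ (by positivity)]
    calc (1 + ‖x‖) ^ N * (‖φ (y - x)‖ * ‖f y‖) * (1 + ‖y‖) ^ D
        ≤ ((1 + ‖y - x‖) * (1 + ‖y‖)) ^ N * (‖φ (y - x)‖ * ‖f y‖) * (1 + ‖y‖) ^ D := by gcongr
      _ = ((1 + ‖y - x‖) ^ N * ‖φ (y - x)‖) * ((1 + ‖y‖) ^ (N + D) * ‖f y‖) := by
          rw [mul_pow, pow_add]; ring
      _ ≤ _ := mul_le_mul (hP _) (hQ f y) (by positivity) (by positivity)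
  rw [integral_const_mul, norm_mul, Complex.norm_real, Real.norm_of_nonneg (by positivity),
    integral_const_mul] at h1
  refine h1.trans (le_of_eq ?_)
  change _ = 2 ^ N * P φ * (2 ^ (N + D)) * I * Q f
  ring

/-- The short-time Fourier transform of a Schwartz function decays rapidly, uniformly on bounded
sets of `𝓢`. -/
theorem exists_seminorm_stft_coe_le (φ : 𝓢(V, ℂ)) (N : ℕ) :
    ∃ q : Seminorm ℂ 𝓢(V, ℂ), Continuous q ∧ ∀ (f : 𝓢(V, ℂ)) (z : V × V),
      weight z ^ N * ‖stft φ (f : 𝓢'(V, ℂ)) z.1 z.2‖ ≤ q f := by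
  obtain ⟨q₁, hq₁, h₁⟩ := exists_seminorm_integral_mul_le φ (2 * N)
  obtain ⟨q₂, hq₂, h₂⟩ := exists_seminorm_integral_mul_le (𝓕 (conjS φ)) (2 * N)
  let F := (fourierInvCLM ℂ 𝓢(V, ℂ) : 𝓢(V, ℂ) →L[ℂ] 𝓢(V, ℂ))
  let c : NNReal := ⟨stftConst V * (2 * Real.pi) ^ (2 * N), by have := stftConst_pos (V := V); positivity⟩
  refine ⟨c • (q₁ + q₂.comp F.toLinearMap), ?_, fun f z => ?_⟩
  · exact (hq₁.add (hq₂.comp F.continuous)).const_smul c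
  have e1 := h₁ f z.1 (fun y => (starRingEnd ℂ) (timeFreqShift z.1 z.2 φ y)) (fun y => by
    rw [RCLike.norm_conj, norm_timeFreqShift_apply])
  rw [← pair_coe] at e1
  have e2 := h₂ (𝓕⁻ f) (-((2 * Real.pi)⁻¹ • z.2))
    (compSubConstCLM ℂ (-((2 * Real.pi)⁻¹ • z.2)) (𝓕 (compSubConstCLM ℂ z.1 (conjS φ))))
    (fun y => by
      rw [compSubConstCLM_apply, fourier_compSubConst, norm_mul, Complex.norm_exp_ofReal_mul_I,
        one_mul])
  -- Moving `𝓕⁻` across the pairing turns the modulation by `ξ` into a translation, so the same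
  -- estimate yields decay in `ξ`.
  have e3 : pair (f : 𝓢'(V, ℂ)) (timeFreqShift z.1 z.2 φ)
      = ∫ y, compSubConstCLM ℂ (-((2 * Real.pi)⁻¹ • z.2)) (𝓕 (compSubConstCLM ℂ z.1 (conjS φ))) y
        * 𝓕⁻ f y := by
    rw [← integral_fourierInv_mul_eq, ← smul_neg, ← modulation_eq_fourierInv, ← timeFreqShift_eq,
      ← conjS_timeFreqShift, pair_coe]
    rfl
  rw [← e3, norm_neg, norm_smul, Real.norm_of_nonneg (by positivity)] at e2
  set a := ‖pair (f : 𝓢'(V, ℂ)) (timeFreqShift z.1 z.2 φ)‖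
  have hpi : 1 ≤ 2 * Real.pi := by linarith [Real.pi_gt_three]
  have h3 : (1 + ‖z.2‖) ^ (2 * N) ≤ (2 * Real.pi) ^ (2 * N) *
      (1 + (2 * Real.pi)⁻¹ * ‖z.2‖) ^ (2 * N) := by
    rw [← mul_pow]
    refine pow_le_pow_left₀ (by positivity) ?_ _
    rw [mul_add, ← mul_assoc, mul_inv_cancel₀ (by positivity)]
    linarith
  have h4 : 1 ≤ (2 * Real.pi) ^ (2 * N) := one_le_pow₀ hpi
  have e4 : (1 + ‖z.2‖) ^ (2 * N) * a ≤ (2 * Real.pi) ^ (2 * N) * q₂ (𝓕⁻ f) := by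
    calc _ ≤ ((2 * Real.pi) ^ (2 * N) * (1 + (2 * Real.pi)⁻¹ * ‖z.2‖) ^ (2 * N)) * a := by gcongr
      _ = (2 * Real.pi) ^ (2 * N) * ((1 + (2 * Real.pi)⁻¹ * ‖z.2‖) ^ (2 * N) * a) := by ring
      _ ≤ _ := by gcongr
  have e5 : (1 + ‖z.1‖) ^ (2 * N) * a ≤ (2 * Real.pi) ^ (2 * N) * q₁ f :=
    e1.trans (le_mul_of_one_le_left (apply_nonneg _ _) h4)
  have e6 : weight z ^ N * a ≤ (2 * Real.pi) ^ (2 * N) * (q₁ f + q₂ (𝓕⁻ f)) := by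
    -- By `ab ≤ a² + b²`, separate decay of order `2N` in `x` and in `ξ` gives joint decay of order
    -- `N`.
    have h6 : weight z ^ N ≤ (1 + ‖z.1‖) ^ (2 * N) + (1 + ‖z.2‖) ^ (2 * N) := by
      rw [weight, mul_pow, mul_comm 2 N, pow_mul, pow_mul]
      nlinarith [sq_nonneg ((1 + ‖z.1‖) ^ N - (1 + ‖z.2‖) ^ N),
        sq_nonneg ((1 + ‖z.1‖) ^ N), sq_nonneg ((1 + ‖z.2‖) ^ N)]
    have : 0 ≤ a := norm_nonneg _
    calc _ ≤ ((1 + ‖z.1‖) ^ (2 * N) + (1 + ‖z.2‖) ^ (2 * N)) * a := by gcongr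
      _ ≤ _ := by linarith
  rw [stft_eq, norm_mul, Complex.norm_real, Real.norm_of_nonneg stftConst_pos.le,
    smul_apply, NNReal.smul_def, smul_eq_mul]
  change _ * (_ * a) ≤ stftConst V * (2 * Real.pi) ^ (2 * N) * (q₁ f + q₂ (𝓕⁻ f))
  calc _ = stftConst V * (weight z ^ N * a) := by ring
    _ ≤ _ := by
      rw [mul_assoc]
      exact mul_le_mul_of_nonneg_left e6 stftConst_pos.le

end STFT

end GaborWF

end

noncomputable section

namespace GaborWF

open FourierTransform

/-! ### Inversion formula, Moyal's identity and change of window. -/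

section Inversion

variable {V : Type*} [NormedAddCommGroup V] [InnerProductSpace ℝ V]
  [FiniteDimensional ℝ V] [MeasurableSpace V] [BorelSpace V]

/-- A family with polynomially bounded seminorms against a rapidly decaying amplitude has
integrable seminorms. -/
theorem integrable_seminorm_smul {H : V × V → ℂ} (hH : Continuous H)
    (hdecay : ∀ N : ℕ, ∃ C : ℝ, ∀ z, weight z ^ N * ‖H z‖ ≤ C)
    {σ : V × V → 𝓢(V, ℂ)} (hσ : Continuous σ) (q : Seminorm ℂ 𝓢(V, ℂ)) (hq : Continuous q)
    (hbound : ∃ (C : ℝ) (N : ℕ), ∀ z, q (σ z) ≤ weight z ^ N * C) :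
    Integrable (fun z => q (H z • σ z)) := by
  obtain ⟨C, N, hC⟩ := hbound
  obtain ⟨D, hD⟩ := exists_integrable_weight_pow (volume : Measure V) (volume : Measure V)
  obtain ⟨C', hC'⟩ := hdecay (N + D)
  refine ((hD D le_rfl).const_mul (C' * C)).mono'
    (hq.comp (hH.smul hσ)).aestronglyMeasurable (.of_forall fun z => ?_)
  have hw := weight_pos z
  have hC0 : 0 ≤ C := by
    have h := (apply_nonneg q (σ z)).trans (hC z)
    exact nonneg_of_mul_nonneg_right h (by positivity)
  rw [Real.norm_of_nonneg (apply_nonneg _ _), map_smul_eq_mul, ← div_eq_mul_inv,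
    le_div_iff₀ (by positivity)]
  calc ‖H z‖ * q (σ z) * weight z ^ D ≤ ‖H z‖ * (weight z ^ N * C) * weight z ^ D := by
        gcongr
        exact hC z
    _ = (weight z ^ (N + D) * ‖H z‖) * C := by rw [pow_add]; ring
    _ ≤ _ := by
        gcongr
        exact hC' z

theorem exists_seminorm_timeFreqShift_le' (φ : 𝓢(V, ℂ)) (q : Seminorm ℂ 𝓢(V, ℂ))
    (hq : Continuous q) :
    ∃ (C : ℝ) (N : ℕ), ∀ z : V × V, q (timeFreqShift z.1 z.2 φ) ≤ weight z ^ N * C := by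
  obtain ⟨q', -, N, h⟩ := exists_seminorm_timeFreqShift_le q hq
  exact ⟨q' φ, N, fun z => h z φ⟩

theorem stft_coe_decay (φ f : 𝓢(V, ℂ)) (N : ℕ) :
    ∃ C : ℝ, ∀ z : V × V, weight z ^ N * ‖stft φ (f : 𝓢'(V, ℂ)) z.1 z.2‖ ≤ C := by
  obtain ⟨q, -, h⟩ := exists_seminorm_stft_coe_le φ N
  exact ⟨q f, h f⟩

theorem integrable_of_weight_decay {E : Type*} [NormedAddCommGroup E] {W : Type*}
    [NormedAddCommGroup W] [InnerProductSpace ℝ W]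
    [FiniteDimensional ℝ W] [MeasurableSpace W] [BorelSpace W] {G : V × W → E}
    (hG : Continuous G) (h : ∀ N : ℕ, ∃ C : ℝ, ∀ z, weight z ^ N * ‖G z‖ ≤ C) : Integrable G := by
  obtain ⟨D, hD⟩ := exists_integrable_weight_pow (volume : Measure V) (volume : Measure W)
  obtain ⟨C, hC⟩ := h D
  refine ((hD D le_rfl).const_mul C).mono' hG.aestronglyMeasurable (.of_forall fun z => ?_)
  have hw := weight_pos z
  rw [← div_eq_mul_inv, le_div_iff₀ (by positivity), mul_comm]
  exact hC z

theorem stft_coe_eq_fourier (φ f : 𝓢(V, ℂ)) (x ξ : V) :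
    stft φ (f : 𝓢'(V, ℂ)) x ξ = stftConst V *
      𝓕 (SchwartzMap.pairing (ContinuousLinearMap.mul ℂ ℂ) f (conjS (compSubConstCLM ℂ x φ)))
        ((2 * Real.pi)⁻¹ • ξ) := by
  rw [stft_eq, pair_coe, fourier_coe, Real.fourier_eq']
  congr 2
  ext y
  rw [timeFreqShift_apply, map_mul, ← Complex.exp_conj, map_mul, Complex.conj_ofReal,
    Complex.conj_I, inner_smul_right, SchwartzMap.pairing_apply_apply, smul_eq_mul,
    ContinuousLinearMap.mul_apply', conjS_apply, compSubConstCLM_apply]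
  have : (-2 * Real.pi * ((2 * Real.pi)⁻¹ * inner ℝ y ξ) : ℝ) = -inner ℝ y ξ := by
    field_simp
  rw [this]
  push_cast
  ring_nf

/-- For fixed `x` the transform is, in `ξ`, a Fourier transform of `f · conj(T_x φ)`, so the
integral is Fourier inversion at `y`. The substitution `ξ = 2πω` produces `(2π)^n`, which cancels
the two normalising constants. -/
theorem integral_stft_mul_timeFreqShift_snd (φ f : 𝓢(V, ℂ)) (x y : V) :
    stftConst V * ∫ ξ, stft φ (f : 𝓢'(V, ℂ)) x ξ * timeFreqShift x ξ φ y
      = f y * ((‖φ (y - x)‖ ^ 2 : ℝ) : ℂ) := by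
  set h : 𝓢(V, ℂ) :=
    SchwartzMap.pairing (ContinuousLinearMap.mul ℂ ℂ) f (conjS (compSubConstCLM ℂ x φ)) with hh
  have hinv : 𝓕⁻ (𝓕 h) y = h y := by rw [FourierPair.fourierInv_fourier_eq]
  rw [fourierInv_coe, Real.fourierInv_eq'] at hinv
  have hpt : ∀ ξ : V, stft φ (f : 𝓢'(V, ℂ)) x ξ * timeFreqShift x ξ φ y
      = (fun ω : V => (stftConst V * φ (y - x)) *
        (Complex.exp ((2 * Real.pi * inner ℝ ω y : ℝ) * Complex.I) • 𝓕 h ω))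
          ((2 * Real.pi)⁻¹ • ξ) := by
    intro ξ
    have : (2 * Real.pi * inner ℝ ((2 * Real.pi)⁻¹ • ξ) y : ℝ) = inner ℝ y ξ := by
      rw [inner_smul_left, real_inner_comm, conj_trivial]
      field_simp
    simp only [this]
    rw [stft_coe_eq_fourier, timeFreqShift_apply, smul_eq_mul]
    ring
  have hsub := Measure.integral_comp_inv_smul (volume : Measure V) (fun ω : V =>
    (stftConst V * φ (y - x)) *
      (Complex.exp ((2 * Real.pi * inner ℝ ω y : ℝ) * Complex.I) • 𝓕 h ω)) (2 * Real.pi)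
  rw [integral_congr_ae (.of_forall hpt), hsub, integral_const_mul, hinv, hh,
    SchwartzMap.pairing_apply_apply, ContinuousLinearMap.mul_apply', conjS_apply,
    compSubConstCLM_apply, abs_of_pos (by positivity)]
  have hc := congrArg (Complex.ofReal) (stftConst_sq_mul (V := V))
  have hn : ((‖φ (y - x)‖ ^ 2 : ℝ) : ℂ) = φ (y - x) * (starRingEnd ℂ) (φ (y - x)) := by
    rw [Complex.mul_conj, Complex.normSq_eq_norm_sq]
  rw [hn, Complex.real_smul]
  push_cast at hc ⊢
  linear_combination (f y * φ (y - x) * (starRingEnd ℂ) (φ (y - x))) * hc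

theorem stft_inversion_apply (φ f : 𝓢(V, ℂ)) (y : V) :
    stftConst V * ∫ z : V × V, stft φ (f : 𝓢'(V, ℂ)) z.1 z.2 * timeFreqShift z.1 z.2 φ y
      = ((∫ x, ‖φ x‖ ^ 2 : ℝ) : ℂ) * f y := by
  have hint : Integrable (fun z : V × V =>
      stft φ (f : 𝓢'(V, ℂ)) z.1 z.2 * timeFreqShift z.1 z.2 φ y) := by
    refine integrable_of_weight_decay ((continuous_stft φ _).mul ?_) fun N => ?_
    · simp only [timeFreqShift_apply]
      fun_prop
    · obtain ⟨C, hC⟩ := stft_coe_decay φ f N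
      refine ⟨C * SchwartzMap.seminorm ℂ 0 0 φ, fun z => ?_⟩
      rw [norm_mul, norm_timeFreqShift_apply, ← mul_assoc]
      have hw := weight_pos z
      exact mul_le_mul (hC z) (SchwartzMap.norm_le_seminorm ℂ φ _) (norm_nonneg _)
        ((by positivity : 0 ≤ weight z ^ N * ‖stft φ (f : 𝓢'(V, ℂ)) z.1 z.2‖).trans (hC z))
  rw [Measure.volume_eq_prod, integral_prod _ hint, ← integral_const_mul]
  simp only [integral_stft_mul_timeFreqShift_snd]
  rw [integral_const_mul, integral_sub_left_eq_self (fun x => ((‖φ x‖ ^ 2 : ℝ) : ℂ)),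
    integral_complex_ofReal, mul_comm]

theorem continuous_stft_smul_timeFreqShift (φ f : 𝓢(V, ℂ)) :
    Continuous fun z : V × V =>
      stft φ (f : 𝓢'(V, ℂ)) z.1 z.2 • timeFreqShift z.1 z.2 φ :=
  (continuous_stft φ _).smul (continuous_timeFreqShift φ)

theorem integrable_seminorm_stft_smul_timeFreqShift (φ f : 𝓢(V, ℂ)) (k n : ℕ) :
    Integrable fun z : V × V => SchwartzMap.seminorm ℂ k n
      (stft φ (f : 𝓢'(V, ℂ)) z.1 z.2 • timeFreqShift z.1 z.2 φ) :=
  integrable_seminorm_smul (continuous_stft φ _) (stft_coe_decay φ f)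
    (continuous_timeFreqShift φ) _ ((schwartz_withSeminorms ℂ V ℂ).continuous_seminorm (k, n))
    (exists_seminorm_timeFreqShift_le' φ _
      ((schwartz_withSeminorms ℂ V ℂ).continuous_seminorm (k, n)))

/-- The inversion formula, tested against a continuous functional. -/
theorem stft_inversion (φ f : 𝓢(V, ℂ)) (u : 𝓢(V, ℂ) →L[ℂ] ℂ) :
    Integrable (fun z : V × V =>
      stft φ (f : 𝓢'(V, ℂ)) z.1 z.2 * u (timeFreqShift z.1 z.2 φ)) ∧
    ((∫ x, ‖φ x‖ ^ 2 : ℝ) : ℂ) * u f = stftConst V *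
      ∫ z : V × V, stft φ (f : 𝓢'(V, ℂ)) z.1 z.2 * u (timeFreqShift z.1 z.2 φ) := by
  have hΘ := continuous_stft_smul_timeFreqShift φ f
  have hint := integrable_seminorm_stft_smul_timeFreqShift φ f
  obtain ⟨h1, h2⟩ := integrable_continuousLinearMap_comp u hΘ hint
  have h3 : (stftConst V : ℂ) • schwartzIntegral volume _ hΘ hint
      = ((∫ x, ‖φ x‖ ^ 2 : ℝ) : ℂ) • f := by
    ext y
    simpa [schwartzIntegral_apply] using stft_inversion_apply φ f y
  have h4 := congrArg u h3
  rw [map_smul, map_smul, h2, smul_eq_mul, smul_eq_mul] at h4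
  simp only [map_smul, smul_eq_mul] at h1 h4
  exact ⟨h1, h4.symm⟩

/-- Covariance: time-frequency shifts compose up to a phase, and the modulus removes the phase. -/
theorem norm_stft_timeFreqShift (Ψ Φ : 𝓢(V, ℂ)) (z w : V × V) :
    ‖stft Ψ (timeFreqShift z.1 z.2 Φ : 𝓢'(V, ℂ)) w.1 w.2‖
      = ‖stft Ψ (Φ : 𝓢'(V, ℂ)) (w.1 - z.1) (w.2 - z.2)‖ := by
  rw [stft_eq, stft_eq, norm_mul, norm_mul, pair_coe, pair_coe]
  congr 1
  rw [← integral_add_right_eq_self _ z.1]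
  have : ∀ y, (starRingEnd ℂ) (timeFreqShift w.1 w.2 Ψ (y + z.1)) * timeFreqShift z.1 z.2 Φ (y + z.1)
      = Complex.exp ((inner ℝ z.1 (z.2 - w.2) : ℝ) * Complex.I) *
        ((starRingEnd ℂ) (timeFreqShift (w.1 - z.1) (w.2 - z.2) Ψ y) * Φ y) := by
    intro y
    simp only [timeFreqShift_apply, map_mul, ← Complex.exp_conj, Complex.conj_ofReal,
      Complex.conj_I, add_sub_cancel_right, inner_add_left, inner_sub_right]
    rw [show y + z.1 - w.1 = y - (w.1 - z.1) by abel]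
    have e : Complex.exp ((inner ℝ y w.2 + inner ℝ z.1 w.2 : ℝ) * -Complex.I) *
        Complex.exp ((inner ℝ y z.2 + inner ℝ z.1 z.2 : ℝ) * Complex.I)
        = Complex.exp ((inner ℝ z.1 z.2 - inner ℝ z.1 w.2 : ℝ) * Complex.I) *
          Complex.exp ((inner ℝ y w.2 - inner ℝ y z.2 : ℝ) * -Complex.I) := by
      rw [← Complex.exp_add, ← Complex.exp_add]
      congr 1
      push_cast
      ring
    linear_combination ((starRingEnd ℂ) (Ψ (y - (w.1 - z.1))) * Φ y) * e
  simp only [this]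
  rw [integral_const_mul, norm_mul, Complex.norm_exp_ofReal_mul_I, one_mul]

theorem integrable_norm_sq (Ψ : 𝓢(V, ℂ)) : Integrable fun x => ‖Ψ x‖ ^ 2 :=
  (Ψ.memLp 2 volume).integrable_norm_pow two_ne_zero

theorem integral_norm_sq_pos {Ψ : 𝓢(V, ℂ)} (hΨ : Ψ ≠ 0) : 0 < ∫ x, ‖Ψ x‖ ^ 2 := by
  obtain ⟨x₀, hx₀⟩ : ∃ x, Ψ x ≠ 0 := by
    by_contra! h
    exact hΨ (SchwartzMap.ext h)
  exact integral_pos_of_integrable_nonneg_nonzero (x := x₀) (by fun_prop) (integrable_norm_sq Ψ)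
    (fun x => by positivity) (by positivity)

theorem integral_norm_sq_eq_one {φ : 𝓢(V, ℂ)} (h : eLpNorm φ 2 volume = 1) :
    ∫ x, ‖φ x‖ ^ 2 = 1 := by
  rw [(φ.memLp 2 volume).eLpNorm_eq_integral_rpow_norm two_ne_zero ENNReal.ofNat_ne_top,
    ENNReal.ofReal_eq_one] at h
  have hnn : 0 ≤ ∫ x, ‖φ x‖ ^ 2 := integral_nonneg fun x => by positivity
  simp only [ENNReal.toReal_ofNat, Real.rpow_ofNat] at h
  rwa [Real.rpow_inv_eq hnn zero_le_one two_ne_zero, Real.one_rpow] at h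

theorem integral_neg_snd {E : Type*} [NormedAddCommGroup E] [NormedSpace ℝ E] (F : V × V → E) :
    ∫ z : V × V, F (z.1, -z.2) = ∫ z, F z := by
  have h : MeasurePreserving (Prod.map id Neg.neg : V × V → V × V) volume volume :=
    (MeasurePreserving.id volume).prod (Measure.measurePreserving_neg volume)
  exact h.integral_comp ((MeasurableEquiv.refl V).prodCongr
    (MeasurableEquiv.neg V)).measurableEmbedding F

theorem integrable_neg_snd {E : Type*} [NormedAddCommGroup E] {F : V × V → E}
    (hF : Integrable F) : Integrable fun z : V × V => F (z.1, -z.2) := by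
  have h : MeasurePreserving (Prod.map id Neg.neg : V × V → V × V) volume volume :=
    (MeasurePreserving.id volume).prod (Measure.measurePreserving_neg volume)
  exact h.integrable_comp_of_integrable hF

theorem stft_conjS_conjS (φ f : 𝓢(V, ℂ)) (x ξ : V) :
    stft (conjS φ) (conjS f : 𝓢'(V, ℂ)) x ξ
      = (starRingEnd ℂ) (stft φ (f : 𝓢'(V, ℂ)) x (-ξ)) := by
  rw [stft_eq, stft_eq, pair_coe, pair_coe, map_mul, Complex.conj_ofReal, ← integral_conj]
  congr 2
  ext y
  rw [map_mul, ← conjS_apply (timeFreqShift x ξ (conjS φ)), conjS_timeFreqShift, conjS_conjS,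
    Complex.conj_conj, conjS_apply]

/-- Moyal's identity for a tempered distribution and a test function. -/
theorem moyal (Ψ g : 𝓢(V, ℂ)) (u : 𝓢'(V, ℂ)) :
    Integrable (fun w : V × V =>
      stft Ψ u w.1 w.2 * (starRingEnd ℂ) (stft Ψ (g : 𝓢'(V, ℂ)) w.1 w.2)) ∧
    ((∫ x, ‖Ψ x‖ ^ 2 : ℝ) : ℂ) * pair u g =
      ∫ w : V × V, stft Ψ u w.1 w.2 * (starRingEnd ℂ) (stft Ψ (g : 𝓢'(V, ℂ)) w.1 w.2) := by
  obtain ⟨h1, h2⟩ := stft_inversion (conjS Ψ) (conjS g) u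
  -- `u` acts linearly whereas `pair` is conjugate linear, so inversion is applied to conjugated
  -- data. This reproduces the integrand with the frequency negated, and the reflection preserves
  -- the measure.
  have hpt : ∀ w : V × V, (stftConst V : ℂ) *
      (stft (conjS Ψ) (conjS g : 𝓢'(V, ℂ)) w.1 w.2 * u (timeFreqShift w.1 w.2 (conjS Ψ)))
      = (fun w : V × V => stft Ψ u w.1 w.2 * (starRingEnd ℂ) (stft Ψ (g : 𝓢'(V, ℂ)) w.1 w.2))
        (w.1, -w.2) := by
    intro w
    simp only
    rw [stft_conjS_conjS, stft_eq_apply Ψ u, neg_neg]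
    ring
  have hn : (∫ x, ‖conjS Ψ x‖ ^ 2) = ∫ x, ‖Ψ x‖ ^ 2 := by
    simp only [conjS_apply, RCLike.norm_conj]
  constructor
  · have := integrable_neg_snd ((h1.const_mul (stftConst V : ℂ)).congr (.of_forall hpt))
    simpa using this
  · rw [hn, ← integral_const_mul] at h2
    rw [← integral_neg_snd, ← integral_congr_ae (.of_forall hpt)]
    exact h2

/-- Change of window: the short-time Fourier transform with window `Φ` is dominated by a
convolution of the one with window `Ψ`. -/
theorem norm_stft_le_integral {Ψ : 𝓢(V, ℂ)} (hΨ : Ψ ≠ 0) (Φ : 𝓢(V, ℂ)) (u : 𝓢'(V, ℂ)) :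
    ∃ c : ℝ, 0 ≤ c ∧ ∀ z : V × V,
      Integrable (fun w : V × V =>
        ‖stft Ψ u w.1 w.2‖ * ‖stft Ψ (Φ : 𝓢'(V, ℂ)) (w.1 - z.1) (w.2 - z.2)‖) ∧
      ‖stft Φ u z.1 z.2‖ ≤ c * ∫ w : V × V,
        ‖stft Ψ u w.1 w.2‖ * ‖stft Ψ (Φ : 𝓢'(V, ℂ)) (w.1 - z.1) (w.2 - z.2)‖ := by
  have hI := integral_norm_sq_pos hΨ
  set I := ∫ x, ‖Ψ x‖ ^ 2
  refine ⟨stftConst V / I, div_nonneg stftConst_pos.le hI.le, fun z => ?_⟩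
  obtain ⟨h1, h2⟩ := moyal Ψ (timeFreqShift z.1 z.2 Φ) u
  have h3 := congrArg norm h2
  rw [norm_mul, Complex.norm_real, Real.norm_of_nonneg hI.le] at h3
  have h1' := h1.norm
  simp only [norm_mul, RCLike.norm_conj, norm_stft_timeFreqShift] at h1'
  refine ⟨h1', ?_⟩
  rw [stft_eq, norm_mul, Complex.norm_real, Real.norm_of_nonneg stftConst_pos.le,
    div_mul_eq_mul_div, mul_div_assoc]
  refine mul_le_mul_of_nonneg_left ?_ stftConst_pos.le
  rw [le_div_iff₀ hI, mul_comm, h3]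
  refine (norm_integral_le_integral_norm _).trans (le_of_eq ?_)
  simp only [norm_mul, RCLike.norm_conj, norm_stft_timeFreqShift]

end Inversion

end GaborWF

end

noncomputable section

namespace GaborWF

/-! ### Independence of weighted bounds from the window. -/

section ChangeOfWindow

variable {V : Type*} [NormedAddCommGroup V] [InnerProductSpace ℝ V]
  [FiniteDimensional ℝ V] [MeasurableSpace V] [BorelSpace V]

/-- Weighted bounds for the short-time Fourier transform, with submultiplicative weights dominated
by `weight`, do not depend on the window. -/
theorem exists_weighted_stft_le {Ψ : 𝓢(V, ℂ)} (hΨ : Ψ ≠ 0) (Φ : 𝓢(V, ℂ)) (u : 𝓢'(V, ℂ))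
    {a b : V × V → ℝ} (ha : ∀ z, 0 ≤ a z) (hb : ∀ z, 0 ≤ b z)
    (ha_add : ∀ z w, a (z + w) ≤ a z * a w) (hb_add : ∀ z w, b (z + w) ≤ b z * b w)
    (ha_neg : ∀ z, a (-z) = a z)
    (ha_le : ∀ z, a z ≤ weight z) (hb_le : ∀ z, b z ≤ weight z) {N M : ℕ} {C : ℝ} (hC : 0 ≤ C)
    (h : ∀ z : V × V, a z ^ N * ‖stft Ψ u z.1 z.2‖ ≤ C * b z ^ M) :
    ∃ C' : ℝ, 0 ≤ C' ∧ ∀ z : V × V, a z ^ N * ‖stft Φ u z.1 z.2‖ ≤ C' * b z ^ M := by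
  have hinv : (volume : Measure (V × V)).IsAddHaarMeasure :=
    inferInstanceAs ((volume : Measure V).prod volume).IsAddHaarMeasure
  obtain ⟨c, hc, hconv⟩ := norm_stft_le_integral hΨ Φ u
  have hcont : Continuous fun w : V × V =>
      weight w ^ (N + M) * ‖stft Ψ (Φ : 𝓢'(V, ℂ)) w.1 w.2‖ :=
    (continuous_weight.pow _).mul (continuous_stft Ψ _).norm
  have hint : Integrable fun w : V × V =>
      weight w ^ (N + M) * ‖stft Ψ (Φ : 𝓢'(V, ℂ)) w.1 w.2‖ := by
    refine integrable_of_weight_decay hcont fun n => ?_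
    obtain ⟨C, hC⟩ := stft_coe_decay Ψ Φ (n + (N + M))
    refine ⟨C, fun z => ?_⟩
    have hw := weight_pos z
    rw [Real.norm_of_nonneg (by positivity), ← mul_assoc, ← pow_add]
    exact hC z
  set J := ∫ w : V × V, weight w ^ (N + M) * ‖stft Ψ (Φ : 𝓢'(V, ℂ)) w.1 w.2‖
  have hJ : 0 ≤ J := integral_nonneg fun w => by
    have := weight_pos w
    positivity
  refine ⟨c * C * J, by positivity, fun z => ?_⟩
  obtain ⟨hi, hle⟩ := hconv z
  -- Submultiplicativity moves `a` from `z` to `w` and `b` from `w` to `z`, each at the price of a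
  -- factor in `w - z`. Those factors are at most powers of `weight (w - z)`, absorbed by the rapid
  -- decay of `V_Ψ Φ`.
  have key : ∫ w : V × V, a z ^ N *
      (‖stft Ψ u w.1 w.2‖ * ‖stft Ψ (Φ : 𝓢'(V, ℂ)) (w.1 - z.1) (w.2 - z.2)‖)
      ≤ ∫ w : V × V, (C * b z ^ M) * (weight (w - z) ^ (N + M) *
        ‖stft Ψ (Φ : 𝓢'(V, ℂ)) (w - z).1 (w - z).2‖) := by
    refine integral_mono (hi.const_mul _) ((hint.comp_sub_right z).const_mul _) fun w => ?_
    have h1 : a z ≤ a w * a (w - z) := by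
      have := ha_add w (-(w - z))
      rwa [ha_neg, show w + -(w - z) = z by abel] at this
    have h2 : b w ≤ b z * b (w - z) := by
      have := hb_add z (w - z)
      rwa [add_sub_cancel] at this
    have hA := ha z
    have hA' := ha w
    have hA'' := ha (w - z)
    have hB := hb z
    have hB' := hb w
    have hB'' := hb (w - z)
    have hW := weight_pos (w - z)
    simp only [Prod.fst_sub, Prod.snd_sub]
    set p := ‖stft Ψ u w.1 w.2‖
    set r := ‖stft Ψ (Φ : 𝓢'(V, ℂ)) (w.1 - z.1) (w.2 - z.2)‖
    calc a z ^ N * (p * r) ≤ (a w * a (w - z)) ^ N * (p * r) := by gcongr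
      _ = (a w ^ N * p) * (a (w - z) ^ N * r) := by rw [mul_pow]; ring
      _ ≤ (C * b w ^ M) * (a (w - z) ^ N * r) :=
          mul_le_mul_of_nonneg_right (h w) (by positivity)
      _ ≤ (C * (b z * b (w - z)) ^ M) * (weight (w - z) ^ N * r) := by
          gcongr
          exact ha_le _
      _ = C * b z ^ M * (b (w - z) ^ M * (weight (w - z) ^ N * r)) := by rw [mul_pow]; ring
      _ ≤ C * b z ^ M * (weight (w - z) ^ M * (weight (w - z) ^ N * r)) := by
          gcongr
          exact hb_le _
      _ = _ := by rw [pow_add]; ring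
  rw [integral_const_mul, integral_const_mul, integral_sub_right_eq_self (fun w : V × V =>
    weight w ^ (N + M) * ‖stft Ψ (Φ : 𝓢'(V, ℂ)) w.1 w.2‖)] at key
  have := ha z
  have h1 := mul_le_mul_of_nonneg_left hle (pow_nonneg this N)
  have h2 := mul_le_mul_of_nonneg_left key hc
  calc _ ≤ _ := h1
    _ = _ := by ring
    _ ≤ _ := h2
    _ = _ := by ring

end ChangeOfWindow

/-! ### Anisotropic dilations and decay in anisotropic cones. -/

section Anisotropic

variable {V : Type*} [NormedAddCommGroup V]

/-- The anisotropic size `max(|x|, |ξ|^{1/s})`, homogeneous for `(x, ξ) ↦ (t x, tˢ ξ)`. -/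
def anisoNorm (s : ℝ) (z : V × V) : ℝ := max ‖z.1‖ (‖z.2‖ ^ s⁻¹)

theorem anisoNorm_nonneg (s : ℝ) (z : V × V) : 0 ≤ anisoNorm s z :=
  le_max_of_le_left (norm_nonneg _)

theorem norm_fst_le_anisoNorm (s : ℝ) (z : V × V) : ‖z.1‖ ≤ anisoNorm s z := le_max_left _ _

theorem norm_snd_le_anisoNorm_rpow {s : ℝ} (hs : 0 < s) (z : V × V) :
    ‖z.2‖ ≤ anisoNorm s z ^ s := by
  calc ‖z.2‖ = (‖z.2‖ ^ s⁻¹) ^ s := (Real.rpow_inv_rpow (norm_nonneg _) hs.ne').symm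
    _ ≤ _ := Real.rpow_le_rpow (by positivity) (le_max_right _ _) hs.le

theorem rpow_le_one_add_pow {x r : ℝ} (hx : 0 ≤ x) (hr : 0 ≤ r) : x ^ r ≤ (1 + x) ^ ⌈r⌉₊ := by
  calc x ^ r ≤ (1 + x) ^ r := Real.rpow_le_rpow hx (by linarith) hr
    _ ≤ (1 + x) ^ (⌈r⌉₊ : ℝ) := Real.rpow_le_rpow_of_exponent_le (by linarith) (Nat.le_ceil r)
    _ = _ := Real.rpow_natCast _ _

/-- With `one_add_anisoNorm_le`, this makes the isotropic and anisotropic sizes polynomially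
equivalent, so rapid decay means the same for both. -/
theorem weight_le_anisoNorm {s : ℝ} (hs : 0 < s) (z : V × V) :
    weight z ≤ 2 * (1 + anisoNorm s z) ^ (1 + ⌈s⌉₊) := by
  have h0 := anisoNorm_nonneg s z
  have h1 := norm_fst_le_anisoNorm s z
  have h2 := (norm_snd_le_anisoNorm_rpow hs z).trans (rpow_le_one_add_pow h0 hs.le)
  have h3 : 1 ≤ (1 + anisoNorm s z) ^ ⌈s⌉₊ := one_le_pow₀ (by linarith)
  calc weight z ≤ (1 + anisoNorm s z) * (2 * (1 + anisoNorm s z) ^ ⌈s⌉₊) := by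
        unfold weight
        gcongr
        linarith
    _ = _ := by rw [pow_add, pow_one]; ring

theorem one_add_anisoNorm_le {s : ℝ} (hs : 0 < s) (z : V × V) :
    1 + anisoNorm s z ≤ 2 * weight z ^ (1 + ⌈s⁻¹⌉₊) := by
  have hw := one_le_weight z
  have h1 : ‖z.1‖ ≤ weight z := by
    unfold weight
    nlinarith [norm_nonneg z.1, norm_nonneg z.2, mul_nonneg (norm_nonneg z.1) (norm_nonneg z.2)]
  have h2 : 1 + ‖z.2‖ ≤ weight z := by
    unfold weight
    nlinarith [norm_nonneg z.1, norm_nonneg z.2, mul_nonneg (norm_nonneg z.1) (norm_nonneg z.2)]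
  have h3 : ‖z.1‖ ≤ weight z ^ (1 + ⌈s⁻¹⌉₊) :=
    h1.trans (le_self_pow₀ hw (by omega))
  have h4 : ‖z.2‖ ^ s⁻¹ ≤ weight z ^ (1 + ⌈s⁻¹⌉₊) := by
    refine (rpow_le_one_add_pow (norm_nonneg _) (by positivity)).trans ?_
    exact (pow_le_pow_left₀ (by positivity) h2 _).trans (pow_le_pow_right₀ hw (by omega))
  have h5 : 1 ≤ weight z ^ (1 + ⌈s⁻¹⌉₊) := one_le_pow₀ hw
  have h6 : anisoNorm s z ≤ weight z ^ (1 + ⌈s⁻¹⌉₊) := max_le h3 h4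
  linarith

variable [NormedSpace ℝ V] {W : Type*} [NormedAddCommGroup W] [NormedSpace ℝ W]

/-- The anisotropic dilation `(x, ξ) ↦ (t x, tˢ ξ)`. -/
def anisoDilation (s t : ℝ) (z : V × V) : V × V := (t • z.1, t ^ s • z.2)

theorem anisoDilation_inv {s t : ℝ} (ht : 0 < t) (z : V × V) :
    anisoDilation s t (t⁻¹ • z.1, (t ^ s)⁻¹ • z.2) = z := by
  have h2 := Real.rpow_pos_of_pos ht s
  ext <;> simp [anisoDilation, smul_smul, ht.ne', h2.ne']

/-- One of the two entries of the maximum defining `anisoNorm` is attained, and the corresponding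
component gets norm exactly `1`. Every point of positive size is thereby a dilate of a point of a
compact sphere. -/
theorem norm_normalise {s : ℝ} (hs : 0 < s) {z : V × V} (hz : 0 < anisoNorm s z) :
    ‖((anisoNorm s z)⁻¹ • z.1, (anisoNorm s z ^ s)⁻¹ • z.2)‖ = 1 := by
  set t := anisoNorm s z with ht
  have h2 := Real.rpow_pos_of_pos hz s
  rw [Prod.norm_mk, norm_smul, norm_smul, norm_inv, norm_inv, Real.norm_of_nonneg hz.le,
    Real.norm_of_nonneg h2.le]
  have h3 : t⁻¹ * ‖z.1‖ ≤ 1 := by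
    rw [inv_mul_le_one₀ hz]
    exact norm_fst_le_anisoNorm s z
  have h4 : (t ^ s)⁻¹ * ‖z.2‖ ≤ 1 := by
    rw [inv_mul_le_one₀ h2]
    exact norm_snd_le_anisoNorm_rpow hs z
  rcases max_choice ‖z.1‖ (‖z.2‖ ^ s⁻¹) with h | h
  · have h5 : t = ‖z.1‖ := h
    rw [max_eq_left]
    · rw [← h5, inv_mul_cancel₀ hz.ne']
    · rwa [← h5, inv_mul_cancel₀ hz.ne']
  · have h5 : t ^ s = ‖z.2‖ := by
      rw [ht, anisoNorm, h, Real.rpow_inv_rpow (norm_nonneg _) hs.ne']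
    rw [max_eq_right]
    · rw [← h5, inv_mul_cancel₀ h2.ne']
    · rwa [← h5, inv_mul_cancel₀ h2.ne']

variable [FiniteDimensional ℝ V]

/-- The pointwise decay condition at the points `(z, 0)`, `z ≠ 0`, holds uniformly for `z` on the
unit sphere. -/
theorem exists_uniform_decay {s : ℝ} {F : V × V → W × W → ℝ}
    (hF : ∀ z : V × V, z ≠ 0 → ∃ U : Set ((V × V) × (W × W)), IsOpen U ∧ (z, 0) ∈ U ∧
      ∀ N : ℕ, ∃ C : ℝ, ∀ p ∈ U, ∀ t : ℝ, 0 < t →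
        t ^ N * F (anisoDilation s t p.1) (anisoDilation s t p.2) ≤ C) :
    ∃ δ > 0, ∀ N : ℕ, ∃ C : ℝ, ∀ (z : V × V) (w : W × W), ‖z‖ = 1 → ‖w‖ < δ →
      ∀ t : ℝ, 0 < t → t ^ N * F (anisoDilation s t z) (anisoDilation s t w) ≤ C := by
  set S : Set ((V × V) × (W × W)) := Metric.sphere 0 1 ×ˢ {0} with hS
  have hcompact : IsCompact S := (isCompact_sphere _ _).prod isCompact_singleton
  obtain ⟨U, hU, hSU, hdecay⟩ : ∃ U : Set ((V × V) × (W × W)), IsOpen U ∧ S ⊆ U ∧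
      ∀ N : ℕ, ∃ C : ℝ, ∀ p ∈ U, ∀ t : ℝ, 0 < t →
        t ^ N * F (anisoDilation s t p.1) (anisoDilation s t p.2) ≤ C := by
    -- Having an open neighbourhood with decay of every order is stable under finite unions, with
    -- the maximum of the constants. Compactness thus passes from points to the whole set `S`.
    refine hcompact.induction_on (p := fun S' => ∃ U : Set ((V × V) × (W × W)), IsOpen U ∧
      S' ⊆ U ∧ ∀ N : ℕ, ∃ C : ℝ, ∀ p ∈ U, ∀ t : ℝ, 0 < t →
        t ^ N * F (anisoDilation s t p.1) (anisoDilation s t p.2) ≤ C) ?_ ?_ ?_ ?_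
    · exact ⟨∅, isOpen_empty, le_rfl, fun N => ⟨0, by simp⟩⟩
    · rintro S₁ S₂ h ⟨U, hU, hSU, hd⟩
      exact ⟨U, hU, h.trans hSU, hd⟩
    · rintro S₁ S₂ ⟨U₁, hU₁, hSU₁, hd₁⟩ ⟨U₂, hU₂, hSU₂, hd₂⟩
      refine ⟨U₁ ∪ U₂, hU₁.union hU₂, Set.union_subset_union hSU₁ hSU₂, fun N => ?_⟩
      obtain ⟨C₁, h₁⟩ := hd₁ N
      obtain ⟨C₂, h₂⟩ := hd₂ N
      refine ⟨max C₁ C₂, ?_⟩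
      rintro p (hp | hp) t ht
      · exact (h₁ p hp t ht).trans (le_max_left _ _)
      · exact (h₂ p hp t ht).trans (le_max_right _ _)
    · rintro ⟨z, w⟩ ⟨hz, hw⟩
      obtain rfl : w = 0 := hw
      obtain ⟨U, hU, hzU, hd⟩ := hF z (by
        rintro rfl
        simp at hz)
      exact ⟨U, mem_nhdsWithin_of_mem_nhds (hU.mem_nhds hzU), U, hU, le_rfl, hd⟩
  obtain ⟨δ, hδ, hthick⟩ := hcompact.exists_thickening_subset_open hU hSU
  refine ⟨δ, hδ, fun N => ?_⟩
  obtain ⟨C, hC⟩ := hdecay N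
  refine ⟨C, fun z w hz hw t ht => hC (z, w) (hthick ?_) t ht⟩
  refine Metric.mem_thickening_iff.mpr ⟨(z, 0), ⟨by simpa using hz, rfl⟩, ?_⟩
  simpa [dist_eq_norm, Prod.dist_eq, hδ] using hw

/-- Rapid decay in `z`, at the expense of polynomial growth in `w`, of a polynomially bounded
function which decays rapidly in an anisotropic conical neighbourhood of `w = 0`. -/
theorem exists_decay_of_aniso {s : ℝ} (hs : 0 < s) {F : V × V → W × W → ℝ}
    (hF0 : ∀ z w, 0 ≤ F z w)
    (hpoly : ∃ (C : ℝ) (N : ℕ), 0 ≤ C ∧ ∀ z w, F z w ≤ C * (weight z * weight w) ^ N)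
    (hF : ∀ z : V × V, z ≠ 0 → ∃ U : Set ((V × V) × (W × W)), IsOpen U ∧ (z, 0) ∈ U ∧
      ∀ N : ℕ, ∃ C : ℝ, ∀ p ∈ U, ∀ t : ℝ, 0 < t →
        t ^ N * F (anisoDilation s t p.1) (anisoDilation s t p.2) ≤ C) (N : ℕ) :
    ∃ (C : ℝ) (M : ℕ), 0 ≤ C ∧ ∀ z w, weight z ^ N * F z w ≤ C * weight w ^ M := by
  obtain ⟨δ, hδ, hdecay⟩ := exists_uniform_decay hF
  obtain ⟨C₀, N₀, hC₀, hpoly⟩ := hpoly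
  -- When the size of `w` is at most `ε` times that of `z`, normalising by the size of `z` leaves a
  -- position part of norm at most `ε` and a frequency part of norm at most `ε ^ s`; both must be
  -- below `δ`. The bound `ε ≤ 1` serves outside the cone.
  obtain ⟨ε, hε, hε1, hεδ, hεsδ⟩ : ∃ ε : ℝ, 0 < ε ∧ ε ≤ 1 ∧ ε < δ ∧ ε ^ s < δ := by
    have hd2 : 0 < δ / 2 := by linarith
    refine ⟨min 1 (min (δ / 2) ((δ / 2) ^ s⁻¹)), by positivity, min_le_left _ _, ?_, ?_⟩
    · exact ((min_le_right _ _).trans (min_le_left _ _)).trans_lt (by linarith)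
    · calc _ ≤ ((δ / 2) ^ s⁻¹) ^ s :=
            Real.rpow_le_rpow (by positivity) ((min_le_right _ _).trans (min_le_right _ _)) hs.le
        _ = δ / 2 := Real.rpow_inv_rpow hd2.le hs.ne'
        _ < δ := by linarith
  set k := 1 + ⌈s⌉₊ with hk
  set l := 1 + ⌈s⁻¹⌉₊ with hl
  -- `weight z ^ N` is bounded by a multiple of `(1 + t) ^ (k * N)`, where `t` is the anisotropic
  -- size of `z`. Exponent `0` handles the term `1`, and exponent `k * N` the top power of `t`.
  obtain ⟨A, hA⟩ := hdecay 0
  obtain ⟨B, hB⟩ := hdecay (k * N)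
  set C₁ := 2 ^ N * (2 ^ (k * N) * (|A| + |B|)) with hC₁
  set C₂ := C₀ * (2 * (ε⁻¹ * 2) ^ k) ^ (N + N₀) with hC₂
  have hC₁0 : 0 ≤ C₁ := by positivity
  have hC₂0 : 0 ≤ C₂ := by positivity
  refine ⟨C₁ + C₂, l * k * (N + N₀) + N₀, by positivity, fun z w => ?_⟩
  have hz := weight_pos z
  have hw1 := one_le_weight w
  have hw := weight_pos w
  have hτz := anisoNorm_nonneg s z
  have hτw := anisoNorm_nonneg s w
  by_cases hcase : anisoNorm s w ≤ ε * anisoNorm s z ∧ 0 < anisoNorm s z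
  · obtain ⟨hle, hpos⟩ := hcase
    set t := anisoNorm s z with ht
    have hts := Real.rpow_pos_of_pos hpos s
    have hw' : ‖(t⁻¹ • w.1, (t ^ s)⁻¹ • w.2)‖ < δ := by
      rw [Prod.norm_mk, norm_smul, norm_smul, norm_inv, norm_inv, Real.norm_of_nonneg hpos.le,
        Real.norm_of_nonneg hts.le]
      refine max_lt ?_ ?_
      · refine lt_of_le_of_lt ?_ hεδ
        rw [inv_mul_le_iff₀ hpos, mul_comm]
        exact (norm_fst_le_anisoNorm s w).trans hle
      · refine lt_of_le_of_lt ?_ hεsδ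
        rw [inv_mul_le_iff₀ hts, mul_comm, ← Real.mul_rpow hε.le hpos.le]
        exact (norm_snd_le_anisoNorm_rpow hs w).trans (Real.rpow_le_rpow hτw hle hs.le)
    have hA' := hA _ _ (norm_normalise hs hpos) hw' t hpos
    have hB' := hB _ _ (norm_normalise hs hpos) hw' t hpos
    rw [anisoDilation_inv hpos, anisoDilation_inv hpos] at hA' hB'
    have hF0' := hF0 z w
    have h1 : (1 + t) ^ (k * N) ≤ 2 ^ (k * N) * (1 + t ^ (k * N)) := by
      have := add_pow_le zero_le_one hτz (k * N)
      rw [one_pow] at this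
      refine this.trans ?_
      gcongr
      · norm_num
      · omega
    calc weight z ^ N * F z w ≤ (2 * (1 + t) ^ k) ^ N * F z w := by
          gcongr
          exact weight_le_anisoNorm hs z
      _ = 2 ^ N * ((1 + t) ^ (k * N) * F z w) := by rw [mul_pow, ← pow_mul]; ring
      _ ≤ 2 ^ N * ((2 ^ (k * N) * (1 + t ^ (k * N))) * F z w) := by gcongr
      _ = 2 ^ N * (2 ^ (k * N) * (t ^ 0 * F z w + t ^ (k * N) * F z w)) := by ring
      _ ≤ C₁ := by
          rw [hC₁]
          gcongr
          · exact hA'.trans (le_abs_self _)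
          · exact hB'.trans (le_abs_self _)
      _ ≤ (C₁ + C₂) * 1 := by linarith
      _ ≤ _ := by
          gcongr
          exact one_le_pow₀ hw1
  -- Outside the cone `z` is dominated by `w`, so the a priori polynomial bound already suffices.
  · have hle : 1 + anisoNorm s z ≤ ε⁻¹ * (1 + anisoNorm s w) := by
      have he : 1 ≤ ε⁻¹ := one_le_inv_iff₀.mpr ⟨hε, hε1⟩
      have h2 : anisoNorm s z ≤ ε⁻¹ * anisoNorm s w := by
        rcases hτz.eq_or_lt with h | h
        · rw [← h]
          positivity
        · rw [le_inv_mul_iff₀ hε]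
          by_contra! hcon
          exact hcase ⟨hcon.le, h⟩
      linarith
    have h3 : weight z ≤ (2 * (ε⁻¹ * 2) ^ k) * weight w ^ (l * k) := by
      calc weight z ≤ 2 * (1 + anisoNorm s z) ^ k := weight_le_anisoNorm hs z
        _ ≤ 2 * (ε⁻¹ * (2 * weight w ^ l)) ^ k := by
            gcongr
            refine hle.trans ?_
            gcongr
            exact one_add_anisoNorm_le hs w
        _ = _ := by rw [← mul_assoc, mul_pow _ (weight w ^ l), ← pow_mul, ← mul_assoc]
    calc weight z ^ N * F z w ≤ weight z ^ N * (C₀ * (weight z * weight w) ^ N₀) := by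
          gcongr
          exact hpoly z w
      _ = C₀ * weight z ^ (N + N₀) * weight w ^ N₀ := by rw [mul_pow, pow_add]; ring
      _ ≤ C₀ * ((2 * (ε⁻¹ * 2) ^ k) * weight w ^ (l * k)) ^ (N + N₀) * weight w ^ N₀ := by gcongr
      _ = C₂ * weight w ^ (l * k * (N + N₀) + N₀) := by
          rw [hC₂, mul_pow _ (weight w ^ (l * k)), ← pow_mul, pow_add (weight w)]
          ring
      _ ≤ _ := by
          gcongr
          linarith

end Anisotropic

end GaborWF

end

noncomputable section

namespace GaborWF

/-! ### Bilinear forms with decaying matrix coefficients are given by operators on `𝓢`. -/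

section BilinearForm

variable {V : Type*} [NormedAddCommGroup V] [InnerProductSpace ℝ V]
  [FiniteDimensional ℝ V] [MeasurableSpace V] [BorelSpace V]

theorem continuous_conjS_timeFreqShift (γ : 𝓢(V, ℂ)) :
    Continuous fun z : V × V => conjS (timeFreqShift z.1 z.2 γ) := by
  simp only [conjS_timeFreqShift]
  exact (continuous_timeFreqShift (conjS γ)).comp
    (by fun_prop : Continuous fun z : V × V => (z.1, -z.2))

theorem exists_seminorm_conjS_timeFreqShift_le (γ : 𝓢(V, ℂ)) (q : Seminorm ℂ 𝓢(V, ℂ))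
    (hq : Continuous q) :
    ∃ (C : ℝ) (N : ℕ), ∀ z : V × V, q (conjS (timeFreqShift z.1 z.2 γ)) ≤ weight z ^ N * C := by
  obtain ⟨C, N, h⟩ := exists_seminorm_timeFreqShift_le' (conjS γ) q hq
  refine ⟨C, N, fun z => ?_⟩
  rw [conjS_timeFreqShift, ← weight_neg_snd z]
  exact h (z.1, -z.2)

variable {γ : 𝓢(V, ℂ)} {L R : 𝓢(V, ℂ) → 𝓢(V, ℂ) →L[ℂ] ℂ}

/-- If a bilinear form decays rapidly in the second argument on pairs of time-frequency shifts, so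
does its partial short-time Fourier transform in the second variable. -/
theorem exists_seminorm_partial_stft_le (hγ : ∫ x, ‖γ x‖ ^ 2 = 1) (hLR : ∀ g f, L g f = R f g)
    (hdecay : ∀ N : ℕ, ∃ (C : ℝ) (M : ℕ), 0 ≤ C ∧ ∀ z w : V × V, weight z ^ N *
      ‖L (timeFreqShift w.1 w.2 γ) (timeFreqShift z.1 z.2 γ)‖ ≤ C * weight w ^ M) (N : ℕ) :
    ∃ q : Seminorm ℂ 𝓢(V, ℂ), Continuous q ∧ ∀ (g : 𝓢(V, ℂ)) (z : V × V),
      weight z ^ N * ‖L g (timeFreqShift z.1 z.2 γ)‖ ≤ q g := by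
  obtain ⟨C, M, hC, h⟩ := hdecay N
  obtain ⟨D, hD⟩ := exists_integrable_weight_pow (volume : Measure V) (volume : Measure V)
  obtain ⟨q, hq, hqle⟩ := exists_seminorm_stft_coe_le γ (M + D)
  set J := ∫ w : V × V, (weight w ^ D)⁻¹
  have hJ : 0 ≤ J := integral_nonneg fun w => by
    have := weight_pos w
    positivity
  let c : NNReal := ⟨stftConst V * (C * J), mul_nonneg stftConst_pos.le (by positivity)⟩
  refine ⟨c • q, hq.const_smul c, fun g z => ?_⟩
  obtain ⟨-, hinv⟩ := stft_inversion γ g (R (timeFreqShift z.1 z.2 γ))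
  rw [hγ, Complex.ofReal_one, one_mul] at hinv
  have hz := weight_pos z
  have h1 : ‖∫ w : V × V, ((weight z ^ N : ℝ) : ℂ) * (stft γ (g : 𝓢'(V, ℂ)) w.1 w.2 *
      R (timeFreqShift z.1 z.2 γ) (timeFreqShift w.1 w.2 γ))‖
      ≤ ∫ w : V × V, (C * q g) * (weight w ^ D)⁻¹ := by
    refine norm_integral_le_of_norm_le ((hD D le_rfl).const_mul _) (.of_forall fun w => ?_)
    have hw := weight_pos w
    rw [norm_mul, norm_mul, Complex.norm_real, Real.norm_of_nonneg (by positivity), ← hLR,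
      ← div_eq_mul_inv, le_div_iff₀ (by positivity)]
    have hs := hqle g w
    set a := ‖stft γ (g : 𝓢'(V, ℂ)) w.1 w.2‖
    calc _ = (weight z ^ N * ‖L (timeFreqShift w.1 w.2 γ) (timeFreqShift z.1 z.2 γ)‖) *
          (a * weight w ^ D) := by ring
      _ ≤ (C * weight w ^ M) * (a * weight w ^ D) :=
          mul_le_mul_of_nonneg_right (h z w) (by positivity)
      _ = C * (weight w ^ (M + D) * a) := by rw [pow_add]; ring
      _ ≤ _ := mul_le_mul_of_nonneg_left hs hC
  rw [integral_const_mul, integral_const_mul, norm_mul, Complex.norm_real,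
    Real.norm_of_nonneg (by positivity)] at h1
  rw [hLR, hinv, norm_mul, Complex.norm_real, Real.norm_of_nonneg stftConst_pos.le, smul_apply,
    NNReal.smul_def, smul_eq_mul]
  change _ ≤ stftConst V * (C * J) * q g
  calc _ = stftConst V * (weight z ^ N * ‖∫ w : V × V, stft γ (g : 𝓢'(V, ℂ)) w.1 w.2 *
      R (timeFreqShift z.1 z.2 γ) (timeFreqShift w.1 w.2 γ)‖) := by ring
    _ ≤ stftConst V * (C * q g * J) := mul_le_mul_of_nonneg_left h1 stftConst_pos.le
    _ = _ := by ring

/-- A separately continuous bilinear form on `𝓢` which decays rapidly in the second argument on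
pairs of time-frequency shifts is given by a continuous operator `T : 𝓢 → 𝓢`; functionals of `T g`
are phase space integrals. -/
theorem exists_operator_of_decay (hγ : ∫ x, ‖γ x‖ ^ 2 = 1) (hLR : ∀ g f, L g f = R f g)
    (hdecay : ∀ N : ℕ, ∃ (C : ℝ) (M : ℕ), 0 ≤ C ∧ ∀ z w : V × V, weight z ^ N *
      ‖L (timeFreqShift w.1 w.2 γ) (timeFreqShift z.1 z.2 γ)‖ ≤ C * weight w ^ M) :
    ∃ T : 𝓢(V, ℂ) →L[ℂ] 𝓢(V, ℂ),
      (∀ g f, (T g : 𝓢'(V, ℂ)) f = L g f) ∧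
      ∀ g (u : 𝓢'(V, ℂ)), u (T g) = stftConst V *
        ∫ z : V × V, L g (timeFreqShift z.1 z.2 γ) * stft γ u z.1 z.2 := by
  have hamp := exists_seminorm_partial_stft_le hγ hLR hdecay
  have hcont : ∀ g, Continuous fun z : V × V => L g (timeFreqShift z.1 z.2 γ) := fun g =>
    (L g).continuous.comp (continuous_timeFreqShift γ)
  have hσ := continuous_conjS_timeFreqShift γ
  have hΘ : ∀ g, Continuous fun z : V × V =>
      L g (timeFreqShift z.1 z.2 γ) • conjS (timeFreqShift z.1 z.2 γ) := fun g =>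
    (hcont g).smul hσ
  have hint : ∀ g k n, Integrable fun z : V × V => SchwartzMap.seminorm ℂ k n
      (L g (timeFreqShift z.1 z.2 γ) • conjS (timeFreqShift z.1 z.2 γ)) := fun g k n =>
    integrable_seminorm_smul (hcont g)
      (fun N => by
        obtain ⟨q, -, h⟩ := hamp N
        exact ⟨q g, h g⟩) hσ _
      ((schwartz_withSeminorms ℂ V ℂ).continuous_seminorm (k, n))
      (exists_seminorm_conjS_timeFreqShift_le γ _
        ((schwartz_withSeminorms ℂ V ℂ).continuous_seminorm (k, n)))
  -- Inserting the inversion formula for `f` into `L g f` and reading off the density in `y` gives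
  -- this integral. One normalising constant comes from inversion, the other from the definition of
  -- `V_γ f`.
  let T₀ : 𝓢(V, ℂ) → 𝓢(V, ℂ) := fun g =>
    ((stftConst V : ℂ) ^ 2) • schwartzIntegral volume _ (hΘ g) (hint g)
  have hT₀ : ∀ g (u : 𝓢(V, ℂ) →L[ℂ] ℂ),
      Integrable (fun z : V × V =>
        L g (timeFreqShift z.1 z.2 γ) * u (conjS (timeFreqShift z.1 z.2 γ))) ∧
      u (T₀ g) = (stftConst V : ℂ) ^ 2 * ∫ z : V × V,
        L g (timeFreqShift z.1 z.2 γ) * u (conjS (timeFreqShift z.1 z.2 γ)) := fun g u => by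
    obtain ⟨h1, h2⟩ := integrable_continuousLinearMap_comp u (hΘ g) (hint g)
    simp only [map_smul, smul_eq_mul] at h1 h2
    exact ⟨h1, by rw [map_smul, h2, smul_eq_mul]⟩
  have hadd : ∀ g₁ g₂, T₀ (g₁ + g₂) = T₀ g₁ + T₀ g₂ := fun g₁ g₂ => by
    ext y
    -- Point evaluation is a continuous functional, so `hT₀` supplies both the integral and its
    -- integrability.
    let δ : 𝓢(V, ℂ) →L[ℂ] ℂ := TemperedDistribution.delta y
    have h := fun g => hT₀ g δ
    change δ (T₀ (g₁ + g₂)) = δ (T₀ g₁) + δ (T₀ g₂)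
    rw [(h _).2, (h g₁).2, (h g₂).2, ← mul_add, ← integral_add (h g₁).1 (h g₂).1]
    simp only [hLR, map_add, add_mul]
  have hsmul : ∀ (c : ℂ) g, T₀ (c • g) = c • T₀ g := fun c g => by
    ext y
    let δ : 𝓢(V, ℂ) →L[ℂ] ℂ := TemperedDistribution.delta y
    have h := fun g => hT₀ g δ
    change δ (T₀ (c • g)) = c * δ (T₀ g)
    rw [(h _).2, (h g).2, mul_left_comm]
    simp only [hLR, map_smul, smul_eq_mul, mul_assoc]
    rw [integral_const_mul]
  have hbound : ∀ i : ℕ × ℕ, ∃ q : Seminorm ℂ 𝓢(V, ℂ), Continuous q ∧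
      ∀ g, schwartzSeminormFamily ℂ V ℂ i (T₀ g) ≤ q g := fun i => by
    obtain ⟨C, M, hC⟩ := exists_seminorm_conjS_timeFreqShift_le γ (schwartzSeminormFamily ℂ V ℂ i)
      ((schwartz_withSeminorms ℂ V ℂ).continuous_seminorm i)
    obtain ⟨D, hD⟩ := exists_integrable_weight_pow (volume : Measure V) (volume : Measure V)
    obtain ⟨q, hq, hqle⟩ := hamp (M + D)
    set J := ∫ w : V × V, (weight w ^ D)⁻¹
    have hJ : 0 ≤ J := integral_nonneg fun w => by
      have := weight_pos w
      positivity
    have hC0 : 0 ≤ C := by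
      have h := (apply_nonneg (schwartzSeminormFamily ℂ V ℂ i) _).trans (hC 0)
      exact nonneg_of_mul_nonneg_right h (pow_pos (weight_pos _) _)
    let c : NNReal := ⟨stftConst V ^ 2 * (C * J), by positivity⟩
    refine ⟨c • q, hq.const_smul c, fun g => ?_⟩
    have h1 := seminorm_schwartzIntegral_le (hΘ g) (hint g) i.1 i.2
    have h2 : ∫ z : V × V, SchwartzMap.seminorm ℂ i.1 i.2
        (L g (timeFreqShift z.1 z.2 γ) • conjS (timeFreqShift z.1 z.2 γ))
        ≤ ∫ z : V × V, (C * q g) * (weight z ^ D)⁻¹ := by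
      refine integral_mono (hint g i.1 i.2) ((hD D le_rfl).const_mul _) fun z => ?_
      have hz := weight_pos z
      simp only
      rw [map_smul_eq_mul, ← div_eq_mul_inv, le_div_iff₀ (by positivity)]
      calc _ ≤ ‖L g (timeFreqShift z.1 z.2 γ)‖ * (weight z ^ M * C) * weight z ^ D := by
            gcongr
            exact hC z
        _ = C * (weight z ^ (M + D) * ‖L g (timeFreqShift z.1 z.2 γ)‖) := by
            rw [pow_add]; ring
        _ ≤ _ := mul_le_mul_of_nonneg_left (hqle g z) hC0
    rw [integral_const_mul] at h2
    have h3 : schwartzSeminormFamily ℂ V ℂ i (T₀ g) = stftConst V ^ 2 *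
        SchwartzMap.seminorm ℂ i.1 i.2 (schwartzIntegral volume _ (hΘ g) (hint g)) := by
      change schwartzSeminormFamily ℂ V ℂ i (_ • _) = _
      rw [map_smul_eq_mul, norm_pow, Complex.norm_real, Real.norm_of_nonneg stftConst_pos.le]
      rfl
    rw [h3, smul_apply, NNReal.smul_def, smul_eq_mul]
    change _ ≤ stftConst V ^ 2 * (C * J) * q g
    calc _ ≤ stftConst V ^ 2 * (C * q g * J) := by
          gcongr
          exact h1.trans h2
      _ = _ := by ring
  let Tl : 𝓢(V, ℂ) →ₗ[ℂ] 𝓢(V, ℂ) := { toFun := T₀, map_add' := hadd, map_smul' := hsmul }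
  have hTcont : Continuous Tl := by
    refine continuous_of_continuousAt_zero Tl ?_
    rw [ContinuousAt, map_zero, (schwartz_withSeminorms ℂ V ℂ).tendsto_nhds]
    intro i ε hε
    obtain ⟨q, hq, h⟩ := hbound i
    have ht := hq.tendsto 0
    rw [map_zero] at ht
    filter_upwards [ht.eventually (gt_mem_nhds hε)] with g hg
    rw [sub_zero]
    exact (h g).trans_lt hg
  have hformula : ∀ g (u : 𝓢'(V, ℂ)), u (T₀ g) = stftConst V *
      ∫ z : V × V, L g (timeFreqShift z.1 z.2 γ) * stft γ u z.1 z.2 := fun g u => by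
    refine (hT₀ g u).2.trans ?_
    simp only [stft_eq, pair, mul_left_comm _ (stftConst V : ℂ)]
    rw [integral_const_mul, ← mul_assoc, ← sq]
    rfl
  refine ⟨⟨Tl, hTcont⟩, fun g f => ?_, hformula⟩
  -- The pairing of two Schwartz functions is symmetric, so `hformula` may be used with `f` as the
  -- distribution; inversion for `f` then recovers `L g f`.
  have h1 : (T₀ g : 𝓢'(V, ℂ)) f = (f : 𝓢'(V, ℂ)) (T₀ g) := by
    rw [SchwartzMap.coe_apply, SchwartzMap.coe_apply]
    simp only [smul_eq_mul, mul_comm]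
  change (T₀ g : 𝓢'(V, ℂ)) f = _
  rw [h1, hformula]
  have h2 := (stft_inversion γ f (L g)).2
  rw [hγ, Complex.ofReal_one, one_mul] at h2
  rw [h2]
  simp only [mul_comm]

end BilinearForm

/-! ### Sequential density of Schwartz functions in the tempered distributions. -/

section Density

variable {V : Type*} [NormedAddCommGroup V] [InnerProductSpace ℝ V]
  [FiniteDimensional ℝ V] [MeasurableSpace V] [BorelSpace V]

theorem exists_integral_norm_sq_eq_one : ∃ φ : 𝓢(V, ℂ), ∫ x, ‖φ x‖ ^ 2 = 1 := by
  let b : ContDiffBump (0 : V) := ⟨1, 2, one_pos, one_lt_two⟩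
  have hsupp : HasCompactSupport fun x => ((b x : ℝ) : ℂ) :=
    b.hasCompactSupport.comp_left (g := fun r : ℝ => (r : ℂ)) Complex.ofReal_zero
  let ψ : 𝓢(V, ℂ) := hsupp.toSchwartzMap (Complex.ofRealCLM.contDiff.comp b.contDiff)
  have hψ : ψ ≠ 0 := fun h => by
    have h1 : ψ 0 = ((b 0 : ℝ) : ℂ) := rfl
    rw [h, b.one_of_mem_closedBall (by simp [b])] at h1
    simp at h1
  have hI := integral_norm_sq_pos hψ
  set I := ∫ x, ‖ψ x‖ ^ 2
  refine ⟨((Real.sqrt I)⁻¹ : ℂ) • ψ, ?_⟩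
  simp only [smul_apply, norm_smul, norm_inv, Complex.norm_real, mul_pow, inv_pow,
    Real.norm_of_nonneg (Real.sqrt_nonneg I), Real.sq_sqrt hI.le]
  rw [integral_const_mul, inv_mul_cancel₀ hI.ne']

/-- Schwartz functions are sequentially dense in the tempered distributions. -/
theorem exists_tendsto_schwartz (u : 𝓢'(V, ℂ)) :
    ∃ f : ℕ → 𝓢(V, ℂ),
      Filter.Tendsto (fun n => (f n : 𝓢'(V, ℂ))) Filter.atTop (nhds u) := by
  obtain ⟨φ, hφ⟩ := exists_integral_norm_sq_eq_one (V := V)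
  have hΘ : Continuous fun z : V × V => ((stftConst V : ℂ) ^ 2 * u (timeFreqShift z.1 z.2 φ)) •
      conjS (timeFreqShift z.1 z.2 φ) :=
    (continuous_const.mul ((ContinuousLinearMap.continuous u).comp
      (continuous_timeFreqShift φ))).smul (continuous_conjS_timeFreqShift φ)
  have hint : ∀ (m : ℕ) k n, Integrable (fun z : V × V => SchwartzMap.seminorm ℂ k n
      (((stftConst V : ℂ) ^ 2 * u (timeFreqShift z.1 z.2 φ)) • conjS (timeFreqShift z.1 z.2 φ)))
      (volume.restrict (Metric.closedBall 0 m)) := fun m k n =>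
    (((schwartz_withSeminorms ℂ V ℂ).continuous_seminorm (k, n)).comp
      hΘ).continuousOn.integrableOn_compact (isCompact_closedBall _ _)
  -- The approximants are inversion integrals for `u` truncated to balls of phase space, where
  -- continuity alone gives integrability. Tested against `h`, they converge because the full
  -- inversion integral for `h` is absolutely convergent.
  refine ⟨fun m => schwartzIntegral _ _ hΘ (hint m), ?_⟩
  rw [PointwiseConvergenceCLM.tendsto_iff_forall_tendsto]
  intro h
  obtain ⟨h1, h2⟩ := stft_inversion φ h u
  rw [hφ, Complex.ofReal_one, one_mul, ← integral_const_mul] at h2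
  have h2' : u h = _ := h2
  rw [h2']
  have hlim := (aecover_closedBall (μ := (volume : Measure (V × V))) (x := 0)
    tendsto_natCast_atTop_atTop).integral_tendsto_of_countably_generated
      (h1.const_mul (stftConst V : ℂ))
  refine hlim.congr fun m => ?_
  have h3 : ∀ f : 𝓢(V, ℂ), (f : 𝓢'(V, ℂ)) h = (h : 𝓢'(V, ℂ)) f := fun f => by
    rw [SchwartzMap.coe_apply, SchwartzMap.coe_apply]
    simp only [smul_eq_mul, mul_comm]
  rw [h3]
  refine Eq.trans ?_ (integrable_continuousLinearMap_comp (h : 𝓢'(V, ℂ)) hΘ (hint m)).2.symm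
  refine integral_congr_ae (.of_forall fun z => ?_)
  refine Eq.trans ?_ (ContinuousLinearMap.map_smul (h : 𝓢'(V, ℂ)) _ _).symm
  simp only [stft_eq, pair, smul_eq_mul]
  rw [← mul_assoc, ← mul_assoc, ← sq, mul_right_comm]
  rfl

end Density

end GaborWF

end

noncomputable section

namespace GaborWF

/-! ### Decay of the kernel's transform from the wave front set conditions. -/

section KernelDecay

variable {d : ℕ}

/-- The component `(x, ξ)` of a phase space point `(x, y, ξ, η)`. -/
def fstPhase (Z : R2d d × R2d d) : Rd d × Rd d := (Z.1.fst, Z.2.fst)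

/-- The component `(y, η)` of a phase space point `(x, y, ξ, η)`. -/
def sndPhase (Z : R2d d × R2d d) : Rd d × Rd d := (Z.1.snd, Z.2.snd)

/-- The phase space point `(x, y, ξ, η)` with components `(x, ξ)` and `(y, η)`. -/
def joinPhase (w z : Rd d × Rd d) : R2d d × R2d d :=
  (WithLp.toLp 2 (w.1, z.1), WithLp.toLp 2 (w.2, z.2))

theorem continuous_joinPhase :
    Continuous fun p : (Rd d × Rd d) × (Rd d × Rd d) => joinPhase p.1 p.2 := by
  unfold joinPhase
  fun_prop

theorem weight_fstPhase_add_le (Z W : R2d d × R2d d) :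
    weight (fstPhase (Z + W)) ≤ weight (fstPhase Z) * weight (fstPhase W) :=
  weight_add_le (fstPhase Z) (fstPhase W)

theorem weight_sndPhase_add_le (Z W : R2d d × R2d d) :
    weight (sndPhase (Z + W)) ≤ weight (sndPhase Z) * weight (sndPhase W) :=
  weight_add_le (sndPhase Z) (sndPhase W)

theorem weight_fstPhase_neg (Z : R2d d × R2d d) : weight (fstPhase (-Z)) = weight (fstPhase Z) :=
  weight_neg (fstPhase Z)

theorem weight_sndPhase_neg (Z : R2d d × R2d d) : weight (sndPhase (-Z)) = weight (sndPhase Z) :=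
  weight_neg (sndPhase Z)

theorem weight_fstPhase_le (Z : R2d d × R2d d) : weight (fstPhase Z) ≤ weight Z := by
  have h1 := WithLp.norm_fst_le (p := 2) (Rd d) Z.1
  have h2 := WithLp.norm_fst_le (p := 2) (Rd d) Z.2
  unfold weight fstPhase
  gcongr

theorem weight_sndPhase_le (Z : R2d d × R2d d) : weight (sndPhase Z) ≤ weight Z := by
  have h1 := WithLp.norm_snd_le (p := 2) (Rd d) Z.1
  have h2 := WithLp.norm_snd_le (p := 2) (Rd d) Z.2
  unfold weight sndPhase
  gcongr

theorem one_add_norm_le_mul (x : R2d d) : 1 + ‖x‖ ≤ (1 + ‖x.fst‖) * (1 + ‖x.snd‖) := by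
  have h : ‖x‖ ≤ ‖x.fst‖ + ‖x.snd‖ := by
    rw [WithLp.prod_norm_eq_of_L2]
    refine Real.sqrt_le_iff.mpr ⟨by positivity, ?_⟩
    nlinarith [norm_nonneg x.fst, norm_nonneg x.snd]
  nlinarith [mul_nonneg (norm_nonneg x.fst) (norm_nonneg x.snd)]

theorem weight_le_fstPhase_mul_sndPhase (Z : R2d d × R2d d) :
    weight Z ≤ weight (fstPhase Z) * weight (sndPhase Z) := by
  calc weight Z ≤ ((1 + ‖Z.1.fst‖) * (1 + ‖Z.1.snd‖)) * ((1 + ‖Z.2.fst‖) * (1 + ‖Z.2.snd‖)) :=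
        mul_le_mul (one_add_norm_le_mul _) (one_add_norm_le_mul _) (by positivity) (by positivity)
    _ = _ := by unfold weight fstPhase sndPhase; ring

variable {s : ℝ} {Ψ : 𝓢(R2d d, ℂ)} {K : 𝓢'(R2d d, ℂ)}

theorem exists_norm_stft_joinPhase_le (Ψ : 𝓢(R2d d, ℂ)) (K : 𝓢'(R2d d, ℂ)) :
    ∃ (C : ℝ) (N : ℕ), 0 ≤ C ∧ ∀ w z : Rd d × Rd d,
      ‖stft Ψ K (joinPhase w z).1 (joinPhase w z).2‖ ≤ C * (weight w * weight z) ^ N := by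
  obtain ⟨C, N, hC, h⟩ := exists_norm_stft_le Ψ K
  refine ⟨C, N, hC, fun w z => (h _).trans ?_⟩
  have := weight_pos (joinPhase w z)
  gcongr
  exact weight_le_fstPhase_mul_sndPhase (joinPhase w z)

/-- If `WF_{g,2}(K) = ∅`, the short-time Fourier transform of `K` decays rapidly in `(y, η)`. -/
theorem exists_stft_decay_sndPhase (hs : 0 < s) (hΨ : Ψ ≠ 0) (hK : gaborWF₂ s Ψ K = ∅)
    (Φ : 𝓢(R2d d, ℂ)) (N : ℕ) :
    ∃ (C : ℝ) (M : ℕ), 0 ≤ C ∧ ∀ Z : R2d d × R2d d,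
      weight (sndPhase Z) ^ N * ‖stft Φ K Z.1 Z.2‖ ≤ C * weight (fstPhase Z) ^ M := by
  -- The sign of the frequency in `gaborWF₂` plays no role, since the whole set is empty.
  have hwf : ∀ z : Rd d × Rd d, z ≠ 0 → joinPhase 0 z ∉ gaborWF s Ψ K := fun z _ hz => by
    have : (z.1, -z.2) ∈ gaborWF₂ s Ψ K := by
      change (WithLp.toLp 2 (0, z.1), WithLp.toLp 2 (0, - -z.2)) ∈ gaborWF s Ψ K
      rwa [neg_neg]
    rw [hK] at this
    exact this
  obtain ⟨C, M, hC, h⟩ := exists_decay_of_aniso (V := Rd d) (W := Rd d) hs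
    (F := fun z w => ‖stft Ψ K (joinPhase w z).1 (joinPhase w z).2‖)
    (fun _ _ => norm_nonneg _)
    (by
      obtain ⟨C, N, hC, h⟩ := exists_norm_stft_joinPhase_le Ψ K
      refine ⟨C, N, hC, fun z w => ?_⟩
      rw [mul_comm (weight z)]
      exact h w z)
    (fun z hz => by
      have h0 : joinPhase 0 z ≠ 0 := fun h => hz (congrArg sndPhase h)
      have h1 := hwf z hz
      simp only [gaborWF, Set.mem_ofPred_eq, not_and, not_not] at h1
      obtain ⟨U, hU, hzU, hd⟩ := h1 h0
      refine ⟨(fun p => joinPhase p.2 p.1) ⁻¹' U,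
        hU.preimage (continuous_joinPhase.comp continuous_swap), hzU, fun N => ?_⟩
      obtain ⟨C, hC⟩ := hd N
      exact ⟨C, fun p hp t ht => hC _ hp t ht⟩) N
  -- The wave front condition concerns `Ψ` only. The passage to `Φ` is made on the weighted bound,
  -- where the partial weights are submultiplicative.
  obtain ⟨C', hC', h'⟩ := exists_weighted_stft_le hΨ Φ K (a := fun Z => weight (sndPhase Z))
    (b := fun Z => weight (fstPhase Z)) (fun _ => (weight_pos _).le) (fun _ => (weight_pos _).le)
    weight_sndPhase_add_le weight_fstPhase_add_le weight_sndPhase_neg weight_sndPhase_le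
    weight_fstPhase_le hC (fun Z => h (sndPhase Z) (fstPhase Z))
  exact ⟨C', M, hC', h'⟩

/-- If `WF_{g,1}(K) = ∅`, the short-time Fourier transform of `K` decays rapidly in `(x, ξ)`. -/
theorem exists_stft_decay_fstPhase (hs : 0 < s) (hΨ : Ψ ≠ 0) (hK : gaborWF₁ s Ψ K = ∅)
    (Φ : 𝓢(R2d d, ℂ)) (N : ℕ) :
    ∃ (C : ℝ) (M : ℕ), 0 ≤ C ∧ ∀ Z : R2d d × R2d d,
      weight (fstPhase Z) ^ N * ‖stft Φ K Z.1 Z.2‖ ≤ C * weight (sndPhase Z) ^ M := by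
  have hwf : ∀ w : Rd d × Rd d, joinPhase w 0 ∉ gaborWF s Ψ K := fun w hw => by
    have : w ∈ gaborWF₁ s Ψ K := hw
    rw [hK] at this
    exact this
  obtain ⟨C, M, hC, h⟩ := exists_decay_of_aniso (V := Rd d) (W := Rd d) hs
    (F := fun w z => ‖stft Ψ K (joinPhase w z).1 (joinPhase w z).2‖)
    (fun _ _ => norm_nonneg _) (exists_norm_stft_joinPhase_le Ψ K)
    (fun w hw => by
      have h0 : joinPhase w 0 ≠ 0 := fun h => hw (congrArg fstPhase h)
      have h1 := hwf w
      simp only [gaborWF, Set.mem_ofPred_eq, not_and, not_not] at h1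
      obtain ⟨U, hU, hzU, hd⟩ := h1 h0
      refine ⟨(fun p => joinPhase p.1 p.2) ⁻¹' U,
        hU.preimage continuous_joinPhase, hzU, fun N => ?_⟩
      obtain ⟨C, hC⟩ := hd N
      exact ⟨C, fun p hp t ht => hC _ hp t ht⟩) N
  obtain ⟨C', hC', h'⟩ := exists_weighted_stft_le hΨ Φ K (a := fun Z => weight (fstPhase Z))
    (b := fun Z => weight (sndPhase Z)) (fun _ => (weight_pos _).le) (fun _ => (weight_pos _).le)
    weight_fstPhase_add_le weight_sndPhase_add_le weight_fstPhase_neg weight_fstPhase_le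
    weight_sndPhase_le hC (fun Z => h (fstPhase Z) (sndPhase Z))
  exact ⟨C', M, hC', h'⟩

theorem tensor_timeFreqShift (w z : Rd d × Rd d) (a b : 𝓢(Rd d, ℂ)) :
    tensor (timeFreqShift w.1 w.2 a) (timeFreqShift z.1 z.2 b)
      = timeFreqShift (joinPhase w z).1 (joinPhase w z).2 (tensor a b) := by
  ext y
  rw [tensor_apply, timeFreqShift_apply, timeFreqShift_apply, timeFreqShift_apply, tensor_apply,
    WithLp.prod_inner_apply]
  change _ = Complex.exp ((inner ℝ y.fst w.2 + inner ℝ y.snd z.2 : ℝ) * Complex.I) *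
    (a (y.fst - w.1) * b (y.snd - z.1))
  rw [Complex.ofReal_add, add_mul, Complex.exp_add]
  ring

theorem stftConst_R2d : stftConst (R2d d) = stftConst (Rd d) ^ 2 := by
  have h : Module.finrank ℝ (R2d d) = d + d := by
    rw [(WithLp.linearEquiv 2 ℝ (Rd d × Rd d)).finrank_eq, Module.finrank_prod,
      finrank_euclideanSpace_fin]
  rw [stftConst, stftConst, h, finrank_euclideanSpace_fin, ← Real.rpow_natCast,
    ← Real.rpow_mul (by positivity)]
  congr 1
  push_cast
  ring

theorem stft_tensor_eq (φ : 𝓢(Rd d, ℂ)) (K : 𝓢'(R2d d, ℂ)) (w z : Rd d × Rd d) :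
    stft (tensor φ φ) K (WithLp.toLp 2 (w.1, z.1)) (WithLp.toLp 2 (w.2, -z.2))
      = (stftConst (Rd d) : ℂ) ^ 2 * K (tensor (timeFreqShift w.1 (-w.2) (conjS φ))
        (timeFreqShift z.1 z.2 (conjS φ))) := by
  have h1 : conjS (tensor φ φ) = tensor (conjS φ) (conjS φ) := by
    ext y
    simp [conjS_apply, tensor_apply]
  have h2 := tensor_timeFreqShift (w.1, -w.2) z (conjS φ) (conjS φ)
  rw [h2, stft_eq_apply, stftConst_R2d, h1, Complex.ofReal_pow]
  congr 4
  change -WithLp.toLp 2 (w.2, -z.2) = WithLp.toLp 2 (-w.2, z.2)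
  rw [← WithLp.toLp_neg, Prod.neg_mk, neg_neg]

/-- This is the link between the bilinear form and the decay estimates: a tensor of shifted windows
is a shifted tensor window. The reversed frequency is harmless because the weights are even. -/
theorem norm_kernel_timeFreqShift (γ : 𝓢(Rd d, ℂ)) (K : 𝓢'(R2d d, ℂ)) (w z : Rd d × Rd d) :
    ‖K (tensor (timeFreqShift w.1 w.2 γ) (timeFreqShift z.1 z.2 γ))‖
      = (stftConst (R2d d))⁻¹ * ‖stft (conjS (tensor γ γ)) K (joinPhase w z).1
        (-(joinPhase w z).2)‖ := by
  have hc := stftConst_pos (V := R2d d)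
  rw [tensor_timeFreqShift, stft_eq_apply, neg_neg, conjS_conjS, norm_mul, Complex.norm_real,
    Real.norm_of_nonneg hc.le, inv_mul_cancel_left₀ hc.ne']

/-- The functional `f ↦ K(g ⊗ f)`. -/
def kernelLeft (K : 𝓢'(R2d d, ℂ)) (g : 𝓢(Rd d, ℂ)) : 𝓢(Rd d, ℂ) →L[ℂ] ℂ :=
  ContinuousLinearMap.comp K (tensorRightCLM g)

/-- The functional `g ↦ K(g ⊗ f)`. -/
def kernelRight (K : 𝓢'(R2d d, ℂ)) (f : 𝓢(Rd d, ℂ)) : 𝓢(Rd d, ℂ) →L[ℂ] ℂ :=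
  ContinuousLinearMap.comp K (tensorLeftCLM f)

theorem kernelLeft_apply (K : 𝓢'(R2d d, ℂ)) (g f : 𝓢(Rd d, ℂ)) :
    kernelLeft K g f = K (tensor g f) := rfl

theorem kernelRight_apply (K : 𝓢'(R2d d, ℂ)) (f g : 𝓢(Rd d, ℂ)) :
    kernelRight K f g = K (tensor g f) := rfl

theorem kernelLeft_decay (hs : 0 < s) (hΨ : Ψ ≠ 0) (hK : gaborWF₂ s Ψ K = ∅) (γ : 𝓢(Rd d, ℂ))
    (N : ℕ) : ∃ (C : ℝ) (M : ℕ), 0 ≤ C ∧ ∀ z w : Rd d × Rd d, weight z ^ N *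
      ‖kernelLeft K (timeFreqShift w.1 w.2 γ) (timeFreqShift z.1 z.2 γ)‖ ≤ C * weight w ^ M := by
  obtain ⟨C, M, hC, h⟩ := exists_stft_decay_sndPhase hs hΨ hK (conjS (tensor γ γ)) N
  have hc := stftConst_pos (V := R2d d)
  refine ⟨(stftConst (R2d d))⁻¹ * C, M, by positivity, fun z w => ?_⟩
  have h1 := h ((joinPhase w z).1, -(joinPhase w z).2)
  have hz : weight (sndPhase ((joinPhase w z).1, -(joinPhase w z).2)) = weight z :=
    weight_neg_snd z
  have hw : weight (fstPhase ((joinPhase w z).1, -(joinPhase w z).2)) = weight w :=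
    weight_neg_snd w
  rw [hz, hw] at h1
  rw [kernelLeft_apply, norm_kernel_timeFreqShift, mul_left_comm, mul_assoc]
  exact mul_le_mul_of_nonneg_left h1 (by positivity)

theorem kernelRight_decay (hs : 0 < s) (hΨ : Ψ ≠ 0) (hK : gaborWF₁ s Ψ K = ∅) (γ : 𝓢(Rd d, ℂ))
    (N : ℕ) : ∃ (C : ℝ) (M : ℕ), 0 ≤ C ∧ ∀ z w : Rd d × Rd d, weight z ^ N *
      ‖kernelRight K (timeFreqShift w.1 w.2 γ) (timeFreqShift z.1 z.2 γ)‖ ≤ C * weight w ^ M := by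
  obtain ⟨C, M, hC, h⟩ := exists_stft_decay_fstPhase hs hΨ hK (conjS (tensor γ γ)) N
  have hc := stftConst_pos (V := R2d d)
  refine ⟨(stftConst (R2d d))⁻¹ * C, M, by positivity, fun z w => ?_⟩
  have h1 := h ((joinPhase z w).1, -(joinPhase z w).2)
  have hz : weight (fstPhase ((joinPhase z w).1, -(joinPhase z w).2)) = weight z :=
    weight_neg_snd z
  have hw : weight (sndPhase ((joinPhase z w).1, -(joinPhase z w).2)) = weight w :=
    weight_neg_snd w
  rw [hz, hw] at h1
  rw [kernelRight_apply, norm_kernel_timeFreqShift, mul_left_comm, mul_assoc]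
  exact mul_le_mul_of_nonneg_left h1 (by positivity)

end KernelDecay

end GaborWF

end

noncomputable section

namespace GaborWF

/-! ### Absolute convergence and partial evaluation of the phase space integral. -/

section PhaseSpaceIntegral

variable {d : ℕ}

/-- The reordering `(x, y, ξ, η) ↦ ((x, ξ), (y, η))`. -/
def phaseReorder (E : Type*) [MeasurableSpace E] : E × E × E × E ≃ᵐ (E × E) × (E × E) :=
  ((MeasurableEquiv.refl E).prodCongr (MeasurableEquiv.prodAssoc.symm.trans
    ((MeasurableEquiv.prodComm.prodCongr (MeasurableEquiv.refl E)).trans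
      MeasurableEquiv.prodAssoc))).trans MeasurableEquiv.prodAssoc.symm

theorem measurePreserving_phaseReorder {E : Type*} [MeasureSpace E]
    [SigmaFinite (volume : Measure E)] :
    MeasurePreserving (phaseReorder E) volume volume := by
  have h1 : MeasurePreserving (MeasurableEquiv.prodAssoc (α := E) (β := E) (γ := E)) volume volume :=
    volume_preserving_prodAssoc
  have h1' : MeasurePreserving (MeasurableEquiv.prodAssoc (α := E) (β := E) (γ := E × E))
    volume volume := volume_preserving_prodAssoc
  have h2 : MeasurePreserving (MeasurableEquiv.prodComm (α := E) (β := E)) volume volume :=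
    Measure.measurePreserving_swap
  have h3 : MeasurePreserving ((MeasurableEquiv.prodComm (α := E) (β := E)).prodCongr
      (MeasurableEquiv.refl E)) volume volume := h2.prod (MeasurePreserving.id volume)
  exact ((MeasurePreserving.id volume).prod ((h1.symm.trans h3).trans h1)).trans h1'.symm

/-- The phase space integrand as a function of `(x, ξ)` and `(y, η)`. -/
def pairedIntegrand (K : 𝓢'(R2d d, ℂ)) (φ ψ : 𝓢(Rd d, ℂ)) (u : 𝓢'(Rd d, ℂ))
    (p : (Rd d × Rd d) × (Rd d × Rd d)) : ℂ :=
  stft (tensor φ φ) K (WithLp.toLp 2 (p.1.1, p.2.1)) (WithLp.toLp 2 (p.1.2, -p.2.2))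
    * (starRingEnd ℂ) (stft φ (ψ : 𝓢'(Rd d, ℂ)) p.1.1 p.1.2) * stft (conjS φ) u p.2.1 p.2.2

theorem phaseSpaceIntegrand_eq (K : 𝓢'(R2d d, ℂ)) (φ ψ : 𝓢(Rd d, ℂ)) (u : 𝓢'(Rd d, ℂ)) :
    phaseSpaceIntegrand K φ ψ u = pairedIntegrand K φ ψ u ∘ phaseReorder (Rd d) := rfl

theorem continuous_pairedIntegrand (K : 𝓢'(R2d d, ℂ)) (φ ψ : 𝓢(Rd d, ℂ)) (u : 𝓢'(Rd d, ℂ)) :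
    Continuous (pairedIntegrand K φ ψ u) := by
  have hj : Continuous fun p : (Rd d × Rd d) × (Rd d × Rd d) =>
      ((WithLp.toLp 2 (p.1.1, p.2.1), WithLp.toLp 2 (p.1.2, -p.2.2)) : R2d d × R2d d) := by
    fun_prop
  have h1 := (continuous_stft (tensor φ φ) K).comp hj
  have h2 := Complex.continuous_conj.comp ((continuous_stft φ (ψ : 𝓢'(Rd d, ℂ))).comp
    (continuous_fst (X := Rd d × Rd d) (Y := Rd d × Rd d)))
  have h3 := (continuous_stft (conjS φ) u).comp
    (continuous_snd (X := Rd d × Rd d) (Y := Rd d × Rd d))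
  exact (h1.mul h2).mul h3

variable {s : ℝ} {Ψ : 𝓢(R2d d, ℂ)} {K : 𝓢'(R2d d, ℂ)}

/-- The growth of `V u` in `(y, η)` is absorbed by the decay of `V K` there. That costs growth of
order `M` in `(x, ξ)`, which the rapid decay of `V ψ` absorbs; `D` spare powers on each side give
integrability. -/
theorem integrable_pairedIntegrand (hs : 0 < s) (hΨ : Ψ ≠ 0) (hK : gaborWF₂ s Ψ K = ∅)
    (φ ψ : 𝓢(Rd d, ℂ)) (u : 𝓢'(Rd d, ℂ)) : Integrable (pairedIntegrand K φ ψ u) := by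
  have hcont := continuous_pairedIntegrand K φ ψ u
  obtain ⟨D, hD⟩ := exists_integrable_weight_pow (volume : Measure (Rd d)) (volume : Measure (Rd d))
  obtain ⟨C₁, N₁, hC₁, h₁⟩ := exists_norm_stft_le (conjS φ) u
  obtain ⟨C₂, M, hC₂, h₂⟩ := exists_stft_decay_sndPhase hs hΨ hK (tensor φ φ) (N₁ + D)
  obtain ⟨C₃, h₃⟩ := stft_coe_decay φ ψ (M + D)
  refine (((hD D le_rfl).mul_prod (hD D le_rfl)).const_mul (C₂ * C₃ * C₁)).mono'
    hcont.aestronglyMeasurable (.of_forall fun p => ?_)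
  obtain ⟨w, z⟩ := p
  have hw := weight_pos w
  have hz := weight_pos z
  have e1 := h₁ z
  have e2 := h₂ (WithLp.toLp 2 (w.1, z.1), WithLp.toLp 2 (w.2, -z.2))
  have e3 := h₃ w
  have hz' : weight (sndPhase ((WithLp.toLp 2 (w.1, z.1), WithLp.toLp 2 (w.2, -z.2)) :
    R2d d × R2d d)) = weight z := weight_neg_snd z
  have hw' : weight (fstPhase ((WithLp.toLp 2 (w.1, z.1), WithLp.toLp 2 (w.2, -z.2)) :
    R2d d × R2d d)) = weight w := rfl
  rw [hz', hw'] at e2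
  rw [pairedIntegrand, norm_mul, norm_mul, RCLike.norm_conj, ← mul_inv, ← div_eq_mul_inv,
    le_div_iff₀ (by positivity)]
  simp only at e2 ⊢
  set a := ‖stft (tensor φ φ) K (WithLp.toLp 2 (w.1, z.1)) (WithLp.toLp 2 (w.2, -z.2))‖
  set b := ‖stft φ (ψ : 𝓢'(Rd d, ℂ)) w.1 w.2‖
  have hb : 0 ≤ weight w ^ (M + D) * b := by positivity
  calc a * b * ‖stft (conjS φ) u z.1 z.2‖ * (weight w ^ D * weight z ^ D)
      ≤ a * b * (C₁ * weight z ^ N₁) * (weight w ^ D * weight z ^ D) := by gcongr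
    _ = C₁ * ((weight z ^ (N₁ + D) * a) * (b * weight w ^ D)) := by rw [pow_add]; ring
    _ ≤ C₁ * ((C₂ * weight w ^ M) * (b * weight w ^ D)) := by gcongr
    _ = C₁ * (C₂ * (weight w ^ (M + D) * b)) := by rw [pow_add]; ring
    _ ≤ C₁ * (C₂ * C₃) := by gcongr
    _ = _ := by ring

/-- This is the inversion formula for `conj ψ`, tested against `g ↦ K(g ⊗ Π(z) conj φ)`, after the
reflection `ξ ↦ -ξ`. -/
theorem integral_pairedIntegrand_fst (φ : 𝓢(Rd d, ℂ)) (hφ : ∫ x, ‖φ x‖ ^ 2 = 1)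
    (ψ : 𝓢(Rd d, ℂ)) (K : 𝓢'(R2d d, ℂ)) (u : 𝓢'(Rd d, ℂ)) (z : Rd d × Rd d) :
    ∫ w, pairedIntegrand K φ ψ u (w, z) = stftConst (Rd d) *
      (kernelLeft K (conjS ψ) (timeFreqShift z.1 z.2 (conjS φ)) * stft (conjS φ) u z.1 z.2) := by
  have hγ : ∫ x, ‖conjS φ x‖ ^ 2 = 1 := by
    simpa only [conjS_apply, RCLike.norm_conj] using hφ
  have h := (stft_inversion (conjS φ) (conjS ψ)
    (kernelRight K (timeFreqShift z.1 z.2 (conjS φ)))).2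
  rw [hγ, Complex.ofReal_one, one_mul, ← integral_neg_snd] at h
  rw [kernelLeft_apply, ← kernelRight_apply, h, ← mul_assoc, ← mul_assoc, ← integral_const_mul,
    ← integral_mul_const]
  congr 1
  ext w
  rw [pairedIntegrand]
  simp only
  rw [stft_tensor_eq, stft_conjS_conjS, neg_neg, kernelRight_apply]
  ring

end PhaseSpaceIntegral

/-! ### Extension to tempered distributions by transposition, and the main theorem. -/

/-- The transpose of a continuous operator on `𝓢`, acting on tempered distributions. -/
def transposeOp {d : ℕ} (T : 𝓢(Rd d, ℂ) →L[ℂ] 𝓢(Rd d, ℂ)) :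
    𝓢'(Rd d, ℂ) →L[ℂ] 𝓢'(Rd d, ℂ) :=
  PointwiseConvergenceCLM.precomp ℂ T

theorem transposeOp_apply {d : ℕ} (T : 𝓢(Rd d, ℂ) →L[ℂ] 𝓢(Rd d, ℂ)) (u : 𝓢'(Rd d, ℂ))
    (g : 𝓢(Rd d, ℂ)) : transposeOp T u g = u (T g) := rfl

theorem coe_apply_comm {d : ℕ} (f g : 𝓢(Rd d, ℂ)) :
    (f : 𝓢'(Rd d, ℂ)) g = (g : 𝓢'(Rd d, ℂ)) f := by
  rw [SchwartzMap.coe_apply, SchwartzMap.coe_apply]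
  simp only [smul_eq_mul, mul_comm]

theorem transposeOp_coe {d : ℕ} {K : 𝓢'(R2d d, ℂ)} {T : 𝓢(Rd d, ℂ) →L[ℂ] 𝓢(Rd d, ℂ)}
    (hT : ∀ g f, (T g : 𝓢'(Rd d, ℂ)) f = kernelLeft K g f) (f : 𝓢(Rd d, ℂ)) :
    transposeOp T (f : 𝓢'(Rd d, ℂ)) = kernelOp K f := by
  ext g
  rw [transposeOp_apply, coe_apply_comm, hT]
  rfl

/-- A sequentially continuous operator on tempered distributions is determined by its values on
Schwartz functions. -/
theorem eq_of_seqContinuous {d : ℕ} {A B : 𝓢'(Rd d, ℂ) →ₗ[ℂ] 𝓢'(Rd d, ℂ)} (hA : SeqContinuous A)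
    (hB : SeqContinuous B)
    (h : ∀ f : 𝓢(Rd d, ℂ), B (f : 𝓢'(Rd d, ℂ)) = A (f : 𝓢'(Rd d, ℂ))) : B = A := by
  ext1 u
  obtain ⟨f, hf⟩ := exists_tendsto_schwartz u
  refine tendsto_nhds_unique (hB hf) ((hA hf).congr fun n => ?_)
  exact (h (f n)).symm

end GaborWF

end

theorem proposition4p2 (d : ℕ) (s : ℝ) (hs : 0 < s)
    (K : 𝓢'(GaborWF.R2d d, ℂ))
    -- an arbitrary nonzero window in the definition of the wave front set of `K`
    (Ψ : 𝓢(GaborWF.R2d d, ℂ)) (hΨ : Ψ ≠ 0)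
    (hK₁ : GaborWF.gaborWF₁ s Ψ K = ∅) (hK₂ : GaborWF.gaborWF₂ s Ψ K = ∅) :
    -- (i) `𝒦 : 𝓢 → 𝓢` is continuous
    (∃ T : 𝓢(GaborWF.Rd d, ℂ) →L[ℂ] 𝓢(GaborWF.Rd d, ℂ),
      ∀ f : 𝓢(GaborWF.Rd d, ℂ),
        (T f : 𝓢'(GaborWF.Rd d, ℂ)) = GaborWF.kernelOp K f) ∧
    -- (ii) `𝒦` extends to a sequentially continuous linear operator `A : 𝓢' → 𝓢'` ...
    ∃ A : 𝓢'(GaborWF.Rd d, ℂ) →ₗ[ℂ] 𝓢'(GaborWF.Rd d, ℂ),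
      (SeqContinuous A ∧ ∀ f : 𝓢(GaborWF.Rd d, ℂ),
        A (f : 𝓢'(GaborWF.Rd d, ℂ)) = GaborWF.kernelOp K f) ∧
      -- ... which is unique,
      (∀ B : 𝓢'(GaborWF.Rd d, ℂ) →ₗ[ℂ] 𝓢'(GaborWF.Rd d, ℂ),
        (SeqContinuous B ∧ ∀ f : 𝓢(GaborWF.Rd d, ℂ),
          B (f : 𝓢'(GaborWF.Rd d, ℂ)) = GaborWF.kernelOp K f) → B = A) ∧
      -- (iii) and given by an absolutely convergent phase space integral
      ∀ φ : 𝓢(GaborWF.Rd d, ℂ), eLpNorm φ 2 volume = 1 →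
        ∀ (u : 𝓢'(GaborWF.Rd d, ℂ)) (ψ : 𝓢(GaborWF.Rd d, ℂ)),
          Integrable (GaborWF.phaseSpaceIntegrand K φ ψ u) volume ∧
          GaborWF.pair (A u) ψ = ∫ p, GaborWF.phaseSpaceIntegrand K φ ψ u p := by
  obtain ⟨γ, hγ⟩ := GaborWF.exists_integral_norm_sq_eq_one (V := GaborWF.Rd d)
  obtain ⟨T₁, hT₁, -⟩ := GaborWF.exists_operator_of_decay (R := GaborWF.kernelLeft K) hγ
    (fun _ _ => rfl) (GaborWF.kernelRight_decay hs hΨ hK₁ γ)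
  obtain ⟨T₂, hT₂, -⟩ := GaborWF.exists_operator_of_decay (R := GaborWF.kernelRight K) hγ
    (fun _ _ => rfl) (GaborWF.kernelLeft_decay hs hΨ hK₂ γ)
  have hA : SeqContinuous (GaborWF.transposeOp T₂).toLinearMap :=
    (GaborWF.transposeOp T₂).continuous.seqContinuous
  refine ⟨⟨T₁, fun f => ?_⟩, (GaborWF.transposeOp T₂).toLinearMap,
    ⟨hA, GaborWF.transposeOp_coe hT₂⟩, fun B hB => ?_, fun φ hφ u ψ => ?_⟩
  · ext g
    exact hT₁ f g
  · exact GaborWF.eq_of_seqContinuous hA hB.1 fun f =>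
      (hB.2 f).trans (GaborWF.transposeOp_coe hT₂ f).symm
  · have hφ' := GaborWF.integral_norm_sq_eq_one hφ
    have hcφ : ∫ x, ‖GaborWF.conjS φ x‖ ^ 2 = 1 := by
      simpa only [GaborWF.conjS_apply, RCLike.norm_conj] using hφ'
    have hint := GaborWF.integrable_pairedIntegrand hs hΨ hK₂ φ ψ u
    have hmp := GaborWF.measurePreserving_phaseReorder (E := GaborWF.Rd d)
    have hemb := (GaborWF.phaseReorder (GaborWF.Rd d)).measurableEmbedding
    -- The integral formula is tied to the window of the construction, so a second operator is built
    -- from `conj φ`. Its transpose also extends `𝒦`, hence agrees with that of `T₂`.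
    obtain ⟨T, hT, hformula⟩ := GaborWF.exists_operator_of_decay (R := GaborWF.kernelRight K) hcφ
      (fun _ _ => rfl) (GaborWF.kernelLeft_decay hs hΨ hK₂ (GaborWF.conjS φ))
    have hTA : (GaborWF.transposeOp T₂).toLinearMap = (GaborWF.transposeOp T).toLinearMap :=
      GaborWF.eq_of_seqContinuous (GaborWF.transposeOp T).continuous.seqContinuous hA fun f =>
        (GaborWF.transposeOp_coe hT₂ f).trans (GaborWF.transposeOp_coe hT f).symm
    rw [GaborWF.phaseSpaceIntegrand_eq]
    refine ⟨(hmp.integrable_comp_emb hemb).mpr hint, ?_⟩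
    have hI : ∫ p, (GaborWF.pairedIntegrand K φ ψ u ∘ GaborWF.phaseReorder (GaborWF.Rd d)) p
        = ∫ p, GaborWF.pairedIntegrand K φ ψ u p := hmp.integral_comp hemb _
    -- Fubini with `(x, ξ)` innermost: that inner integral collapses to the amplitude appearing in
    -- `hformula`.
    rw [hI, hTA, Measure.volume_eq_prod, integral_prod_symm _ hint]
    refine (hformula (GaborWF.conjS ψ) u).trans ?_
    rw [← integral_const_mul]
    simp only [GaborWF.integral_pairedIntegrand_fst φ hφ']
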